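/- Let $T$ be a complete first-order theory and let $|T|$ denote the number of first-order formulas of its language (so $|T|\ge\aleph_0$). For a model $M$, let $\mathbf S(M)$ be the set of complete $1$-types over $M$; call $p,q\in\mathbf S(M)$ conjugate if some automorphism of $M$ maps $p$ to $q$, and let $\mathfrak S_{\mathrm{aut}}(M)$ be the set of conjugacy classes. A model $M$ is saturated if every complete $1$-type over a subset of $M$ of cardinality less than $|M|$ is realized in $M$. The theory $T$ is independent if some formula $\varphi(\bar x,\bar y)$ has the independence property: for every $n$ there are, in a model of $T$, tuples $\bar a_i$ ($i<n$) and $\bar b_s$ ($s\subseteq n$) with $\varphi(\bar b_s,\bar a_i)$ true exactly when $i\in s$. It is dependent otherwise. It is unstable if some formula $\varphi(\bar x,\bar y)$ has the order property: for every $n$ there are, in a model of $T$, tuples $\bar a_i,\bar b_i$ ($i<n$) with $\varphi(\bar a_i,\bar b_j)$ true exactly when $i<j$. As usual, $\lambda^{<\lambda}=\sup_{\kappa<\lambda}\lambda^{\kappa}$. (1) If $T$ is independent, $\lambda=\lambda^{<\lambda}>|T|$ and $\lambda=2^\mu$ for some cardinal $\mu$, then $|\mathfrak S_{\mathrm{aut}}(M)|=2^\lambda$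 for every saturated model $M$ of $T$ of cardinality $\lambda$. (2) If $T$ is unstable and dependent, and $\lambda=\aleph_\zeta$ satisfies $\lambda=\lambda^{<\lambda}>|T|$, then $|\mathfrak S_{\mathrm{aut}}(M)|\ge|\zeta+1|$ for every saturated model $M$ of $T$ of cardinality $\lambda$. -/

import Mathlib

open scoped Cardinal FirstOrder

universe u v w

namespace FirstOrder.Language

section Theories

variable {L : Language.{u, v}} (T : L.Theory)

/-- The cardinal `|T|` of a theory `T` in the language `L`: the number of first-order
formulas of `L`, that is, the cardinality of the vocabulary plus `ℵ₀`. -/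
noncomputable def Theory.size (_T : L.Theory) : Cardinal.{max u v} :=
  max ℵ₀ L.card

/-- The formula `φ(x̄, ȳ)` has the independence property in `T`: for every `n`, some model of `T`
contains tuples `a i` (`i < n`) and `b s` (`s ⊆ n`) such that `φ(b s, a i)` holds iff `i ∈ s`. -/
def Theory.HasIndependenceProperty {k m : ℕ} (φ : L.Formula (Fin k ⊕ Fin m)) : Prop :=
  ∀ n : ℕ, ∃ N : Theory.ModelType.{u, v, max u v} T,
    ∃ (a : Fin n → Fin m → N) (b : Set (Fin n) → Fin k → N),
      ∀ (i : Fin n) (s : Set (Fin n)), φ.Realize (Sum.elim (b s) (a i)) ↔ i ∈ s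

/-- `T` is independent: some formula has the independence property in `T`. -/
def Theory.IsIndependent : Prop :=
  ∃ (k m : ℕ) (φ : L.Formula (Fin k ⊕ Fin m)), T.HasIndependenceProperty φ

/-- `T` is dependent (NIP): no formula has the independence property in `T`. -/
def Theory.IsDependent : Prop :=
  ¬ T.IsIndependent

/-- The formula `φ(x̄, ȳ)` has the order property in `T`: for every `n`, some model of `T`
contains tuples `a i`, `b i` (`i < n`) such that `φ(a i, b j)` holds iff `i < j`. -/
def Theory.HasOrderProperty {k m : ℕ} (φ : L.Formula (Fin k ⊕ Fin m)) : Prop :=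
  ∀ n : ℕ, ∃ N : Theory.ModelType.{u, v, max u v} T,
    ∃ (a : Fin n → Fin k → N) (b : Fin n → Fin m → N),
      ∀ i j : Fin n, φ.Realize (Sum.elim (a i) (b j)) ↔ i < j

/-- `T` is stable: no formula has the order property in `T`. -/
def Theory.IsStable : Prop :=
  ¬ ∃ (k m : ℕ) (φ : L.Formula (Fin k ⊕ Fin m)), T.HasOrderProperty φ

end Theories

section Params

variable {L : Language.{u, v}} {M : Type w}

/-- The translation of formulas `φ(x, ā)`, with parameters `ā` from `M`, into `φ(x, f(ā))`. The
formulas are coded as sentences with constants for the elements of `M` and for the variable. -/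
def mapParams (f : M → M) : L[[M]][[Fin 1]].Sentence → L[[M]][[Fin 1]].Sentence :=
  ((L.lhomWithConstantsMap f).addConstants (Fin 1)).onSentence

theorem mapParams_id : mapParams (L := L) (id : M → M) = id := by
  have h : (L.lhomWithConstantsMap (id : M → M)).addConstants (Fin 1) = LHom.id _ := by
    ext n x
    · rcases x with (x | x) | x
      · rfl
      · cases n with
        | zero => rfl
        | succ n => exact PEmpty.elim x
      · cases n with
        | zero => rfl
        | succ n => rfl
    · rcases x with (x | x) | x
      · rfl
      · exact Empty.elim x
      · rfl
  unfold mapParams LHom.onSentence LHom.onFormula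
  rw [h, LHom.id_onBoundedFormula]

theorem mapParams_comp (f g : M → M) :
    mapParams (L := L) (f ∘ g) = mapParams f ∘ mapParams g := by
  have h : (L.lhomWithConstantsMap (f ∘ g)).addConstants (Fin 1) =
      ((L.lhomWithConstantsMap f).addConstants (Fin 1)).comp
        ((L.lhomWithConstantsMap g).addConstants (Fin 1)) := by
    ext n x
    · rcases x with (x | x) | x
      · rfl
      · cases n with
        | zero => rfl
        | succ n => exact PEmpty.elim x
      · cases n with
        | zero => rfl
        | succ n => rfl
    · rcases x with (x | x) | x
      · rfl
      · exact Empty.elim x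
      · rfl
  unfold mapParams LHom.onSentence LHom.onFormula
  rw [h, LHom.comp_onBoundedFormula]

end Params

section Models

variable (L : Language.{u, v}) (M : Type w) [L.Structure M] [Nonempty M]

/-- `M` is `κ`-saturated: every complete 1-type over a set `A ⊆ M` of fewer than `κ` parameters
(a type consistent with the theory of `M` with constants for the elements of `A`) is realized
in `M`. -/
def IsSaturatedAt (κ : Cardinal.{w}) : Prop :=
  ∀ A : Set M, #A < κ → ∀ p : (L[[A]].completeTheory M).CompleteType (Fin 1),
    p ∈ (L[[A]].completeTheory M).realizedTypes M (Fin 1)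

/-- `M` is saturated: it is `κ`-saturated for `κ` the cardinality of `M`. -/
def IsSaturated : Prop :=
  IsSaturatedAt L M #M

/-- The set `S(M)` of complete 1-types over `M`. -/
abbrev OneTypes : Type (max u v w) :=
  (L.elementaryDiagram M).CompleteType (Fin 1)

variable {L M}

/-- The types `p`, `q` over `M` are conjugate: some automorphism `g` of `M` maps `p` to `q`. -/
def Conjugate (p q : OneTypes L M) : Prop :=
  ∃ g : M ≃[L] M, (q : Set L[[M]][[Fin 1]].Sentence) = mapParams (L := L) g '' p

variable (L M)

/-- Conjugacy as an equivalence relation on `S(M)`. -/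
def conjugacy : Setoid (OneTypes L M) where
  r := Conjugate
  iseqv :=
    { refl := fun p => ⟨Equiv.refl L M, by
        have h : ((Equiv.refl L M : M ≃[L] M) : M → M) = id := rfl
        rw [h, mapParams_id, Set.image_id]⟩
      symm := by
        rintro p q ⟨g, hg⟩
        refine ⟨g.symm, ?_⟩
        have h : ((g.symm : M ≃[L] M) : M → M) ∘ g = id := by
          funext x
          exact g.symm_apply_apply x
        rw [hg, ← Set.image_comp, ← mapParams_comp, h, mapParams_id, Set.image_id]
      trans := by
        rintro p q r ⟨g, hg⟩ ⟨f, hf⟩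
        refine ⟨f.comp g, ?_⟩
        have h : ((f.comp g : M ≃[L] M) : M → M) = f ∘ g := rfl
        rw [hf, hg, h, mapParams_comp, Set.image_comp] }

/-- The number of complete 1-types over `M` up to conjugacy by automorphisms of `M`. -/
noncomputable def numTypesUpToConj : Cardinal.{max u v w} :=
  #(Quotient (conjugacy L M))

end Models

end FirstOrder.Language

/-! Types over `M` are produced as averages of sequences in `M` along ultrafilters. They are told
apart up to conjugacy by one formula whose object variable is a single element.

Independent case. Saturation gives a family `c` of `μ` elements, all of whose subsets are cut out by
instances of one formula, so distinct ultrafilters on `μ` give distinct averages. By Pospíšil's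
theorem there are `2 ^ 2 ^ μ = 2 ^ λ` of them. If several averages are conjugate to one type, then
the restriction to `c` of the conjugating automorphism determines the ultrafilter
(`eq_of_conjugate_averageType`). Hence a conjugacy class contains at most `λ ^ μ ≤ λ` of these
averages, and `2 ^ λ` classes are needed. Conversely there are only `2 ^ λ` types.

Unstable dependent case. For every regular `κ < λ` there is a sequence of length `κ` ordered by a
fixed formula. By dependence and Ramsey's theorem it can be chosen so that every instance of the
formula is eventually constant along it. Its average along a tail ultrafilter remembers the
cofinality `κ`: an automorphism matching averages of different cofinalities would, by saturation,
yield an instance true on all of one sequence and false on a tail of the other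
(`IsSaturatedAt.not_conjugate_averageType`). The regular cardinals below `ℵ_ ζ` supply `|ζ|` such
classes, and a realized type adds one.

Both cases need a formula in a single object variable. `IndependentRel.of_forall_not` and
`OrderedRel.of_forall_not` transfer one coordinate of a tuple to the other side: if no pattern
relation for that coordinate already has the property, then the property survives with the
coordinate fixed as a parameter. -/

/-! ### Ramsey's theorem and the number of ultrafilters -/

/-- The infinite Ramsey theorem for colourings of increasing `n`-tuples of natural numbers. -/
theorem exists_strictMono_homogeneous {C : Type*} [Finite C] (n : ℕ) :
    ∀ c : (Fin n → ℕ) → C, ∃ h : ℕ → ℕ, StrictMono h ∧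
      ∃ k, ∀ e : Fin n → ℕ, StrictMono e → c (h ∘ e) = k := by
  induction n with
  | zero => exact fun c => ⟨id, strictMono_id, c ![], fun e _ => congrArg c (Subsingleton.elim _ _)⟩
  | succ n ih =>
    intro c
    choose H hH K hK using ih
    -- `d g` colours `n`-tuples from the tail of `g` by prefixing `g 0`; `F` drops `g 0` and thins
    -- the tail until `d g` is constant on it. The heads `G i 0` then form a sequence on which the
    -- colour of a tuple depends only on its first entry, and pigeonhole fixes that colour.
    let d : (ℕ → ℕ) → (Fin n → ℕ) → C := fun g e => c (Fin.cons (g 0) fun i => g (e i + 1))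
    let F : (ℕ → ℕ) → ℕ → ℕ := fun g m => g (H (d g) m + 1)
    let G : ℕ → ℕ → ℕ := fun i => F^[i] id
    have hG : ∀ i, G (i + 1) = F (G i) := fun i => Function.iterate_succ_apply' F i id
    have hGm : ∀ i, StrictMono (G i) := by
      intro i
      induction i with
      | zero => exact strictMono_id
      | succ i ih =>
        rw [hG]
        exact fun a b hab => ih (Nat.succ_lt_succ (hH _ hab))
    have hsub : ∀ i k, ∃ m, G (i + k) 0 = G i m ∧ ∀ x, ∃ y, G (i + k) x = G i y := by
      intro i k
      suffices ∀ x, ∃ y, G (i + k) x = G i y from ⟨_, (this 0).choose_spec, this⟩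
      induction k with
      | zero => exact fun x => ⟨x, rfl⟩
      | succ k ih =>
        intro x
        rw [← add_assoc, hG]
        exact ih _
    have ha : StrictMono fun i => G i 0 := by
      refine strictMono_nat_of_lt_succ fun i => ?_
      rw [hG]
      exact hGm i (Nat.succ_pos _)
    obtain ⟨k, hk⟩ := Finite.exists_infinite_fiber fun i => K (d (G i))
    let S : Set ℕ := (fun i => K (d (G i))) ⁻¹' {k}
    have hS : S.Infinite := Set.infinite_coe_iff.1 hk
    refine ⟨fun m => G (Nat.nth (· ∈ S) m) 0, fun a b hab => ha (Nat.nth_strictMono hS hab), k,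
      fun e he => ?_⟩
    set t : Fin (n + 1) → ℕ := fun l => Nat.nth (· ∈ S) (e l) with ht
    have htm : StrictMono t := fun a b hab => Nat.nth_strictMono hS (he hab)
    have hkt : K (d (G (t 0))) = k := Nat.nth_mem_of_infinite hS (e 0)
    have hex : ∀ l : Fin n, ∃ m, G (t l.succ) 0 = G (t 0 + 1) m := by
      intro l
      obtain ⟨q, hq⟩ := Nat.exists_eq_add_of_le (Nat.succ_le_of_lt (htm (Fin.succ_pos l)))
      rw [hq]
      exact ⟨_, (hsub (t 0 + 1) q).choose_spec.1⟩
    choose e' he' using hex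
    have hem : StrictMono e' := by
      intro a b hab
      rw [← (hGm (t 0 + 1)).lt_iff_lt, ← he', ← he']
      exact ha (htm (Fin.succ_lt_succ_iff.2 hab))
    rw [← hkt, ← hK (d (G (t 0))) e' hem]
    refine congrArg c ?_
    funext l
    refine Fin.cases rfl (fun l => ?_) l
    simp only [Function.comp_apply, Fin.cons_succ]
    rw [he' l, hG]

/-- Pospíšil's theorem: an infinite set carries doubly exponentially many ultrafilters. -/
theorem two_power_two_power_le_mk_ultrafilter (ι : Type u) [Infinite ι] :
    (2 : Cardinal.{u}) ^ ((2 : Cardinal.{u}) ^ #ι) ≤ #(Ultrafilter ι) := by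
  classical
  have hcard : #(Finset ι × Finset (Finset ι)) = #ι := by simp
  obtain ⟨e⟩ := Cardinal.eq.1 hcard
  -- Hausdorff's independent family: the sets `E X` realize all Boolean patterns on finitely many
  -- `X`, so each `P` gives an ultrafilter deciding every `E X` according to `X ∈ P`.
  let E : Set ι → Set (Finset ι × Finset (Finset ι)) := fun X =>
    {q | q.1.filter (· ∈ X) ∈ q.2}
  let A : Set (Set ι) → Set ι → Set (Finset ι × Finset (Finset ι)) := fun P X =>
    {q | q ∈ E X ↔ X ∈ P}
  have hfip : ∀ (P : Set (Set ι)) (𝒳 : Finset (Set ι)), (⋂ X ∈ 𝒳, A P X).Nonempty := by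
    intro P 𝒳
    have hsep : ∀ q : Set ι × Set ι, ∃ x : ι, q.1 ≠ q.2 → ¬(x ∈ q.1 ↔ x ∈ q.2) := by
      intro q
      by_cases h : q.1 = q.2
      · exact ⟨Classical.arbitrary ι, fun h' => absurd h h'⟩
      · have : ¬∀ x, x ∈ q.1 ↔ x ∈ q.2 := fun h' => h (Set.ext h')
        obtain ⟨x, hx⟩ := not_forall.1 this
        exact ⟨x, fun _ => hx⟩
    choose x hx using hsep
    -- `F` contains a point separating any two distinct members of `𝒳`, so these have distinct
    -- traces on `F` and the traces can be selected freely.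
    let F : Finset ι := (𝒳 ×ˢ 𝒳).image x
    refine ⟨(F, (𝒳.filter (· ∈ P)).image fun X => F.filter (· ∈ X)), ?_⟩
    simp only [Set.mem_iInter]
    intro X hX
    change (F.filter (· ∈ X) ∈ (𝒳.filter (· ∈ P)).image fun X => F.filter (· ∈ X)) ↔ X ∈ P
    constructor
    · intro h
      obtain ⟨Y, hY, hYX⟩ := Finset.mem_image.1 h
      obtain ⟨hY𝒳, hYP⟩ := Finset.mem_filter.1 hY
      by_cases hne : Y = X
      · exact hne ▸ hYP
      · have hmem : x (Y, X) ∈ F :=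
          Finset.mem_image_of_mem _ (Finset.mem_product.2 ⟨hY𝒳, hX⟩)
        have := Finset.ext_iff.1 hYX (x (Y, X))
        simp only [Finset.mem_filter, hmem, true_and] at this
        exact absurd this (hx (Y, X) hne)
    · exact fun h => Finset.mem_image.2 ⟨X, Finset.mem_filter.2 ⟨hX, h⟩, rfl⟩
  have hU : ∀ P : Set (Set ι), ∃ D : Ultrafilter (Finset ι × Finset (Finset ι)), ∀ X, A P X ∈ D := by
    intro P
    obtain ⟨D, hD⟩ := Ultrafilter.exists_ultrafilter_of_finite_inter_nonempty (Set.range (A P)) (by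
      intro T hT
      have : ∃ 𝒳 : Finset (Set ι), ↑T = A P '' 𝒳 := by
        obtain ⟨s, hs⟩ := Finset.subset_set_image_iff.1 (by simpa using hT : (T : Set _) ⊆ A P '' Set.univ)
        exact ⟨s, by rw [← hs.2]; simp⟩
      obtain ⟨𝒳, h𝒳⟩ := this
      rw [h𝒳, Set.sInter_image]
      exact hfip P 𝒳)
    exact ⟨D, fun X => hD ⟨X, rfl⟩⟩
  choose D hD using hU
  have hinj : Function.Injective fun P => (D P).map e := by
    intro P Q h
    have h' : D P = D Q := Ultrafilter.coe_injective
      (Filter.map_injective e.injective (congrArg (fun U : Ultrafilter ι => (U : Filter ι)) h))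
    ext X
    have hQ := hD Q X
    rw [← h'] at hQ
    obtain ⟨q, hq1, hq2⟩ := Ultrafilter.nonempty_of_mem (Filter.inter_mem (hD P X) hQ)
    exact hq1.symm.trans hq2
  have := Cardinal.mk_le_of_injective hinj
  simpa using this

/-! ### Average types, and saturation as solvability of systems -/

namespace FirstOrder.Language

open Theory

section AverageTypes

variable {L : Language.{u, v}} (T : L.Theory) {M : Type w} [L.Structure M] [Nonempty M] [M ⊨ T]
  {ι : Type*}

/-- The average type of a family of elements along an ultrafilter. -/
def Theory.averageType (D : Ultrafilter ι) (c : ι → M) : T.CompleteType (Fin 1) where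
  toTheory := {φ | ∀ᶠ i in D, φ ∈ T.typeOf fun _ : Fin 1 => c i}
  subset' := fun φ hφ => Filter.Eventually.of_forall fun i =>
    (T.typeOf fun _ : Fin 1 => c i).subset hφ
  isMaximal' := by
    rw [IsMaximal, isSatisfiable_iff_isFinitelySatisfiable]
    refine ⟨fun s hs => ?_, fun φ => ?_⟩
    · have : ∀ᶠ i in D, ∀ φ ∈ s, φ ∈ T.typeOf fun _ : Fin 1 => c i :=
        (Filter.eventually_all_finset (l := (D : Filter ι)) s).2 fun φ hφ => hs hφ
      obtain ⟨i, hi⟩ := this.exists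
      exact (T.typeOf fun _ : Fin 1 => c i).isMaximal.1.mono fun φ hφ => hi φ hφ
    · refine Ultrafilter.eventually_or.1 ?_
      exact Filter.Eventually.of_forall fun i => CompleteType.mem_or_not_mem _ _

variable {T}

theorem Theory.mem_averageType {D : Ultrafilter ι} {c : ι → M} {φ : L[[Fin 1]].Sentence} :
    φ ∈ T.averageType D c ↔ ∀ᶠ i in D, φ ∈ T.typeOf fun _ : Fin 1 => c i :=
  Iff.rfl

end AverageTypes

section Saturation

variable {L : Language.{u, v}} {M : Type w} [L.Structure M] [Nonempty M] {κ : Cardinal.{w}}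

/-- In a `κ`-saturated structure, a family of sets definable over fewer than `κ` parameters with
the finite intersection property has a common element. -/
theorem IsSaturatedAt.exists_forall_mem (h : IsSaturatedAt L M κ) {A : Set M} (hA : #A < κ)
    (S : Set (Set M)) (hdef : ∀ s ∈ S, A.Definable₁ L s)
    (hfip : ∀ t : Finset (Set M), (t : Set (Set M)) ⊆ S → ∃ x, ∀ s ∈ t, x ∈ s) :
    ∃ x, ∀ s ∈ S, x ∈ s := by
  obtain ⟨D, hD⟩ := Ultrafilter.exists_ultrafilter_of_finite_inter_nonempty S fun t ht => by
    obtain ⟨x, hx⟩ := hfip t ht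
    exact ⟨x, Set.mem_sInter.2 hx⟩
  -- The average of all elements of `M` along `D` is a complete type over `A` containing the
  -- formulas that define members of `S`.
  obtain ⟨x, hx⟩ := h A hA ((L[[A]].completeTheory M).averageType D id)
  refine ⟨x 0, fun s hs => ?_⟩
  obtain ⟨φ, hφ⟩ := hdef s hs
  have hφ' : ∀ y : Fin 1 → M, φ.Realize y ↔ y 0 ∈ s := fun y => by
    have := Set.ext_iff.1 hφ y
    exact this.symm
  have hmem : Formula.equivSentence φ ∈ (L[[A]].completeTheory M).averageType D id := by
    rw [mem_averageType]
    filter_upwards [hD hs] with y hy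
    rw [CompleteType.formula_mem_typeOf, hφ']
    exact hy
  rw [← hx, CompleteType.formula_mem_typeOf, hφ'] at hmem
  exact hmem

/-- In a `κ`-saturated structure, a finitely satisfiable system of fewer than `κ` unknowns, whose
conditions are definable over fewer than `κ` parameters, has a solution. -/
theorem IsSaturatedAt.exists_solution (hκ : ℵ₀ ≤ κ) (h : IsSaturatedAt L M κ) {Γ : Type w}
    (hΓ : #Γ < κ) {A : Set M} (hA : #A < κ) {J : Type*} {V : J → Type*} [∀ j, Finite (V j)]
    (R : ∀ j, Set (V j → M)) (hR : ∀ j, A.Definable L (R j)) (f : ∀ j, V j → Γ)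
    (hfin : ∀ s : Finset J, ∃ v : Γ → M, ∀ j ∈ s, v ∘ f j ∈ R j) :
    ∃ v : Γ → M, ∀ j, v ∘ f j ∈ R j := by
  classical
  -- `P G`: the partial assignment with graph `G` is compatible with every finite set of conditions.
  -- A maximal such `G` is a function, and 1-saturation makes it total.
  let P : Set (Γ × M) → Prop := fun G => ∀ (s : Finset J) (t : Finset (Γ × M)),
    (t : Set (Γ × M)) ⊆ G → ∃ v : Γ → M, (∀ q ∈ t, v q.1 = q.2) ∧ ∀ j ∈ s, v ∘ f j ∈ R j
  obtain ⟨G, -, hG⟩ := zorn_subset_nonempty {G | P G} (by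
    intro c hc hchain hne
    refine ⟨⋃₀ c, fun s t ht => ?_, fun G hG => Set.subset_sUnion_of_mem hG⟩
    obtain ⟨G, hGc, htG⟩ := DirectedOn.exists_mem_subset_of_finset_subset_biUnion
      (f := fun G : Set (Γ × M) => G) hne (hchain.directedOn) (s := t)
      (by rwa [← Set.sUnion_eq_biUnion])
    exact hc hGc s t htG) ∅ (by
    intro s t ht
    obtain ⟨v, hv⟩ := hfin s
    exact ⟨v, fun q hq => absurd (ht hq) (Set.notMem_empty q), hv⟩)
  have hfun : ∀ γ x y, (γ, x) ∈ G → (γ, y) ∈ G → x = y := by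
    intro γ x y hx hy
    obtain ⟨v, hv, -⟩ := hG.prop ∅ {(γ, x), (γ, y)} (by
      intro q hq
      simp only [Finset.coe_insert, Finset.coe_singleton, Set.mem_insert_iff,
        Set.mem_singleton_iff] at hq
      rcases hq with rfl | rfl <;> assumption)
    exact (hv (γ, x) (by simp)).symm.trans (hv (γ, y) (by simp))
  let B : Set M := A ∪ Prod.snd '' G
  have hB : #B < κ := by
    refine (Cardinal.mk_union_le _ _).trans_lt (Cardinal.add_lt_of_lt hκ hA ?_)
    refine Cardinal.mk_image_le.trans_lt (lt_of_le_of_lt ?_ hΓ)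
    refine Cardinal.mk_le_of_injective (f := fun q : G => q.1.1) ?_
    rintro ⟨⟨γ, x⟩, hx⟩ ⟨⟨δ, y⟩, hy⟩ (rfl : γ = δ)
    cases hfun _ _ _ hx hy
    rfl
  have htot : ∀ γ, ∃ x, (γ, x) ∈ G := by
    intro γ
    -- The values for `γ` compatible with finitely many conditions and finitely many assigned
    -- values. Such a set is a projection of a set definable over `B`, and a common element of all
    -- of them extends `G`.
    let E : Finset J × {t : Finset (Γ × M) // (t : Set (Γ × M)) ⊆ G} → Set M := fun q =>
      {x | ∃ v : Γ → M, v γ = x ∧ (∀ p ∈ q.2.1, v p.1 = p.2) ∧ ∀ j ∈ q.1, v ∘ f j ∈ R j}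
    obtain ⟨x, hx⟩ := h.exists_forall_mem hB (Set.range E) (by
      rintro _ ⟨⟨s, t, ht⟩, rfl⟩
      let W : Finset Γ := insert γ (t.image Prod.fst ∪
        s.biUnion fun j => (Set.finite_range (f j)).toFinset)
      have hW1 : γ ∈ W := Finset.mem_insert_self _ _
      have hW2 : ∀ p ∈ t, p.1 ∈ W := fun p hp => Finset.mem_insert_of_mem
        (Finset.mem_union_left _ (Finset.mem_image_of_mem _ hp))
      have hW3 : ∀ j ∈ s, ∀ i, f j i ∈ W := fun j hj i => Finset.mem_insert_of_mem
        (Finset.mem_union_right _ (Finset.mem_biUnion.2 ⟨j, hj, by simp⟩))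
      let g : (j : s) → V j → W := fun j i => ⟨f j i, hW3 j j.2 i⟩
      have hd1 : B.Definable L (⋂ p : t, {w : W → M | w ⟨p.1.1, hW2 p p.2⟩ = p.1.2}) := by
        refine Set.definable_iInter_of_finite fun p => ?_
        have := Set.Definable.singleton_of_mem (L := L) (A := B) (a := p.1.2)
          (Or.inr ⟨p.1, ht p.2, rfl⟩)
        exact Set.Definable.preimage_comp (fun _ => (⟨p.1.1, hW2 p p.2⟩ : W)) this
      have hd2 : B.Definable L (⋂ j : s, {w : W → M | w ∘ g j ∈ R j}) :=
        Set.definable_iInter_of_finite fun j =>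
          ((hR j).mono Set.subset_union_left).preimage_comp (g j)
      have hd := (hd1.inter hd2).image_comp fun _ : Fin 1 => (⟨γ, hW1⟩ : W)
      unfold Set.Definable₁
      convert hd using 1
      ext x
      constructor
      · rintro ⟨v, hvx, hvt, hvs⟩
        refine ⟨fun i => v i, ⟨?_, ?_⟩, ?_⟩
        · exact Set.mem_iInter.2 fun p => hvt p p.2
        · exact Set.mem_iInter.2 fun j => hvs j j.2
        · funext i
          rw [Subsingleton.elim i 0]
          exact hvx
      · rintro ⟨w, ⟨hw1, hw2⟩, rfl⟩
        refine ⟨fun δ => if hδ : δ ∈ W then w ⟨δ, hδ⟩ else Classical.arbitrary M, ?_, ?_, ?_⟩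
        · simp only [hW1, dite_true]
          rfl
        · intro p hp
          simp only [hW2 p hp, dite_true]
          exact Set.mem_iInter.1 hw1 ⟨p, hp⟩
        · intro j hj
          have := Set.mem_iInter.1 hw2 ⟨j, hj⟩
          have he : (fun δ => if hδ : δ ∈ W then w ⟨δ, hδ⟩ else Classical.arbitrary M) ∘ f j =
              w ∘ g ⟨j, hj⟩ := by
            funext i
            simp only [Function.comp_apply, hW3 j hj i, dite_true]
            rfl
          rw [he]
          exact this) (by
      intro T hT
      choose q hq using fun s : T => hT s.2
      obtain ⟨v, hvt, hvs⟩ := hG.prop (Finset.univ.biUnion fun s => (q s).1)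
        (Finset.univ.biUnion fun s => (q s).2.1) (by
          intro p hp
          obtain ⟨s, -, hp⟩ := Finset.mem_biUnion.1 hp
          exact (q s).2.2 hp)
      refine ⟨v γ, fun s hs => ?_⟩
      have hqs : E (q ⟨s, hs⟩) = s := hq ⟨s, hs⟩
      rw [← hqs]
      exact ⟨v, rfl,
        fun p hp => hvt p (Finset.mem_biUnion.2 ⟨_, Finset.mem_univ _, hp⟩),
        fun j hj => hvs j (Finset.mem_biUnion.2 ⟨_, Finset.mem_univ _, hj⟩)⟩)
    refine ⟨x, ?_⟩
    have hP : P (insert (γ, x) G) := by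
      intro s t ht
      have ht' : ((t.erase (γ, x) : Finset _) : Set (Γ × M)) ⊆ G := by
        intro p hp
        have hp := Finset.mem_erase.1 hp
        exact (ht hp.2).resolve_left hp.1
      obtain ⟨v, hvx, hvt, hvs⟩ := hx _ ⟨(s, ⟨_, ht'⟩), rfl⟩
      refine ⟨v, fun p hp => ?_, hvs⟩
      by_cases hpx : p = (γ, x)
      · rw [hpx]
        exact hvx
      · exact hvt p (Finset.mem_erase.2 ⟨hpx, hp⟩)
    exact hG.le_of_ge hP (Set.subset_insert _ _) (Set.mem_insert _ _)
  choose v hv using htot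
  refine ⟨v, fun j => ?_⟩
  obtain ⟨v', hv't, hv's⟩ := hG.prop {j}
    ((Set.finite_range (f j)).toFinset.image fun γ => (γ, v γ)) (by
      intro p hp
      obtain ⟨γ, -, rfl⟩ := Finset.mem_image.1 hp
      exact hv γ)
  have : v ∘ f j = v' ∘ f j := by
    funext i
    exact (hv't (f j i, v (f j i)) (Finset.mem_image.2 ⟨f j i, by simp, rfl⟩)).symm
  rw [this]
  exact hv's j (Finset.mem_singleton_self j)

end Saturation

end FirstOrder.Language

/-! ### Combinatorics of independent and ordered relations -/

/-- A relation is independent if arbitrarily large finite families are shattered by it. -/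
def IndependentRel {X Y : Type*} (R : X → Y → Prop) : Prop :=
  ∀ n : ℕ, ∃ (a : Fin n → X) (b : Set (Fin n) → Y), ∀ i s, R (a i) (b s) ↔ i ∈ s

/-- A relation is ordered if it defines arbitrarily large finite linear orders. -/
def OrderedRel {X Y : Type*} (R : X → Y → Prop) : Prop :=
  ∀ n : ℕ, ∃ (a : Fin n → X) (b : Fin n → Y), ∀ i j, R (a i) (b j) ↔ i < j

section Rel

variable {X Y Z : Type*} {R : X → Y → Prop}

theorem IndependentRel.swap (h : IndependentRel R) : IndependentRel fun y x => R x y := by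
  intro n
  obtain ⟨a, b, hab⟩ := h (Nat.card (Set (Fin n)))
  let e := Finite.equivFin (Set (Fin n))
  -- Points on the old first side are indexed by the subsets of `Fin n`; the `i`-th point on the
  -- other side selects the subsets containing `i`.
  refine ⟨fun i => b {k | i ∈ e.symm k}, fun s => a (e s), fun i s => ?_⟩
  refine (hab _ _).trans ?_
  simp

theorem OrderedRel.swap (h : OrderedRel R) : OrderedRel fun y x => R x y := by
  intro n
  obtain ⟨a, b, hab⟩ := h n
  exact ⟨fun i => b i.rev, fun j => a j.rev, fun i j => (hab _ _).trans Fin.rev_lt_rev⟩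

theorem OrderedRel.of_not (h : OrderedRel fun x y => ¬R x y) : OrderedRel R := by
  intro n
  obtain ⟨a, b, hab⟩ := h (n + 1)
  -- Negation and reversal turn `<` into `≤`; the extra index absorbs the shift by one that restores
  -- strictness.
  refine ⟨fun i => a i.rev.castSucc, fun j => b j.castSucc.rev, fun i j => ?_⟩
  refine not_iff_not.1 ((hab _ _).trans ?_)
  simp only [not_lt, Fin.lt_def, Fin.val_castSucc, Fin.val_rev]
  omega

/-- Along a sequence which is homogeneous for the patterns of a relation that is not independent,
the relation is eventually constant. -/
theorem eventually_const_of_homogeneous {K : Type*} [LinearOrder K] [Nonempty K] [NoMaxOrder K]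
    {n N : ℕ} (D : (Fin n → X) → Y → Prop)
    (hN : ¬∃ (a : Fin N → Fin n → X) (b : Set (Fin N) → Y), ∀ i s, D (a i) (b s) ↔ i ∈ s)
    (a : K → X)
    (hom : ∀ (r : Set (Fin N)) (e e' : Fin (N * n) → K), StrictMono e → StrictMono e' →
      (∃ y, ∀ l, D (fun i => a (e (finProdFinEquiv (l, i)))) y ↔ l ∈ r) →
      ∃ y, ∀ l, D (fun i => a (e' (finProdFinEquiv (l, i)))) y ↔ l ∈ r) (y : Y) :
    ∃ (t : K) (q : Prop), ∀ e : Fin n → K, StrictMono e → (∀ i, t ≤ e i) →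
      (D (a ∘ e) y ↔ q) := by
  by_contra hcon
  push Not at hcon
  have hpick : ∀ (t : K) (q : Prop), ∃ e : Fin n → K, StrictMono e ∧ (∀ i, t ≤ e i) ∧
      (D (a ∘ e) y ↔ q) := by
    intro t q
    obtain ⟨e, he, hte, hq⟩ := hcon t ¬q
    exact ⟨e, he, hte, by tauto⟩
  choose p hp1 hp2 hp3 using hpick
  have hub : ∀ (t : K) (e : Fin n → K), ∃ t', t < t' ∧ ∀ i, e i < t' := by
    intro t e
    obtain ⟨m, hm⟩ := Finite.exists_le (fun i : Option (Fin n) => i.elim t e)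
    obtain ⟨t', ht'⟩ := exists_gt m
    exact ⟨t', (hm none).trans_lt ht', fun i => (hm (some i)).trans_lt ht'⟩
  choose ub hub1 hub2 using hub
  -- If the relation changes its truth value arbitrarily far out, then `N` consecutive blocks of
  -- length `n` can be picked one after another with truth values prescribed by `r`.
  have hex : ∀ r : Set (Fin N), ∃ e : Fin (N * n) → K, StrictMono e ∧
      ∀ l, D (fun i => a (e (finProdFinEquiv (l, i)))) y ↔ l ∈ r := by
    intro r
    let q : ℕ → Prop := fun l => ∃ h : l < N, (⟨l, h⟩ : Fin N) ∈ r
    let T : ℕ → K := fun l =>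
      Nat.rec (Classical.arbitrary K) (fun l t => ub t (p t (q l))) l
    have hT : ∀ l, T (l + 1) = ub (T l) (p (T l) (q l)) := fun l => rfl
    have hTm : StrictMono T := strictMono_nat_of_lt_succ fun l => by
      rw [hT]
      exact hub1 _ _
    refine ⟨fun k => p (T (finProdFinEquiv.symm k).1) (q (finProdFinEquiv.symm k).1)
      (finProdFinEquiv.symm k).2, ?_, ?_⟩
    · intro k k' hkk'
      obtain ⟨⟨l, i⟩, rfl⟩ := finProdFinEquiv.surjective k
      obtain ⟨⟨l', i'⟩, rfl⟩ := finProdFinEquiv.surjective k'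
      simp only [Equiv.symm_apply_apply]
      have hlt : (i : ℕ) + n * l < i' + n * l' := hkk'
      rcases lt_trichotomy l l' with hl | rfl | hl
      · calc p (T l) (q l) i < T (l + 1) := by rw [hT]; exact hub2 _ _ i
          _ ≤ T l' := hTm.monotone hl
          _ ≤ _ := hp2 _ _ _
      · exact hp1 _ _ (by rw [Fin.lt_def]; omega)
      · exfalso
        have : n * ((l' : ℕ) + 1) ≤ n * l := Nat.mul_le_mul_left n hl
        have := i'.2
        rw [Nat.mul_add] at *
        omega
    · intro l
      simp only [Equiv.symm_apply_apply]
      refine (hp3 (T l) (q l)).trans ⟨fun ⟨_, h⟩ => h, fun h => ⟨l.2, h⟩⟩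
  choose e he1 he2 using hex
  -- Homogeneity moves all these patterns to the single tuple `e ∅`, which is thereby shattered,
  -- contrary to `hN`.
  have hall : ∀ r : Set (Fin N), ∃ y, ∀ l,
      D (fun i => a (e ∅ (finProdFinEquiv (l, i)))) y ↔ l ∈ r := fun r =>
    hom r (e r) (e ∅) (he1 r) (he1 ∅) ⟨y, he2 r⟩
  choose b hb using hall
  exact hN ⟨_, b, fun i s => hb s i⟩

/-- Ramsey's theorem is applied with the set of realizable patterns on `N` blocks of length `n` as
the colour of an `N * n`-tuple; this is the homogeneity that forces eventual constancy. -/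
theorem exists_subsequence_eventually_const {n : ℕ} (D : (Fin n → X) → Y → Prop)
    (hD : ¬IndependentRel D) (a : ℕ → X) :
    ∃ h : ℕ → ℕ, StrictMono h ∧ ∀ y, ∃ (t : ℕ) (q : Prop), ∀ e : Fin n → ℕ, StrictMono e →
      (∀ i, t ≤ e i) → (D (fun i => a (h (e i))) y ↔ q) := by
  obtain ⟨N, hN⟩ := not_forall.1 hD
  obtain ⟨h, hh, k, hk⟩ := exists_strictMono_homogeneous (N * n) fun e : Fin (N * n) → ℕ =>
    {r : Set (Fin N) | ∃ y, ∀ l, D (fun i => a (e (finProdFinEquiv (l, i)))) y ↔ l ∈ r}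
  refine ⟨h, hh, eventually_const_of_homogeneous D hN (a ∘ h) fun r e e' he he' hr => ?_⟩
  have : r ∈ k := by
    rw [← hk e he]
    exact hr
  rw [← hk e' he'] at this
  exact this

/-- Moving a variable to the other side preserves independence, unless some pattern relation for
this variable is independent. -/
theorem IndependentRel.of_forall_not {R : X → Y → Z → Prop} (a : ℕ → X)
    (ha : ∀ S : Set ℕ, ∃ y z, ∀ i, R (a i) y z ↔ i ∈ S)
    (hn : ∀ (n : ℕ) (s : Set (Fin n)),
      ¬IndependentRel fun (x : Fin n → X) (y : Y) => ∃ z, ∀ i, R (x i) y z ↔ i ∈ s) :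
    IndependentRel fun (x : X × Y) (z : Z) => R x.1 x.2 z := by
  intro n
  have hsub : ∀ F : Finset (Set (Fin n)), ∃ h : ℕ → ℕ, StrictMono h ∧ ∀ s ∈ F, ∀ y,
      ∃ (t : ℕ) (q : Prop), ∀ e : Fin n → ℕ, StrictMono e → (∀ i, t ≤ e i) →
        ((∃ z, ∀ i, R (a (h (e i))) y z ↔ i ∈ s) ↔ q) := by
    classical
    intro F
    induction F using Finset.induction_on with
    | empty => exact ⟨id, strictMono_id, fun s hs => absurd hs (Finset.notMem_empty s)⟩
    | insert s F _ ih =>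
      obtain ⟨h, hh, hF⟩ := ih
      obtain ⟨h', hh', hs⟩ := exists_subsequence_eventually_const _ (hn n s) (a ∘ h)
      refine ⟨h ∘ h', hh.comp hh', fun s' hs' y => ?_⟩
      rcases Finset.mem_insert.1 hs' with rfl | hs'
      · exact hs y
      · obtain ⟨t, q, htq⟩ := hF s' hs' y
        exact ⟨t, q, fun e he hte => htq (h' ∘ e) (hh'.comp he) fun i =>
          (hte i).trans (hh'.id_le (e i))⟩
  obtain ⟨h, hh, hconst⟩ := hsub (Set.toFinite Set.univ).toFinset
  -- An alternating instance shows every pattern `s` infinitely often for this one `y`. Since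
  -- realizability of `s` over `y` is eventually constant, it is eventually true, so `y` can be
  -- frozen and a tail segment is shattered by varying `z`.
  obtain ⟨y, z, hyz⟩ := ha (h '' {i | Even i})
  have hyz' : ∀ i, R (a (h i)) y z ↔ Even i := fun i =>
    (hyz (h i)).trans (hh.injective.mem_set_image)
  choose t q htq using fun s : Set (Fin n) => hconst s (by simp) y
  have hq : ∀ s, q s := by
    classical
    intro s
    -- The `i`-th index lies in the pair `2 * (t s + i)`, `2 * (t s + i) + 1`; its parity encodes
    -- whether `i ∈ s`.
    refine (htq s (fun i => 2 * (t s + i) + if i ∈ s then 0 else 1) ?_ ?_).1 ⟨z, fun i => ?_⟩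
    · intro i j hij
      have : (i : ℕ) < j := hij
      dsimp only
      split_ifs <;> omega
    · intro i
      omega
    · rw [hyz']
      split_ifs with hi <;> simp [hi, parity_simps]
  obtain ⟨m, hm⟩ := Finite.exists_le t
  choose b hb using fun s => (htq s (fun i => m + i) (fun i j hij => by simpa using hij)
    fun i => (hm s).trans (Nat.le_add_right _ _)).2 (hq s)
  exact ⟨fun i => (a (h (m + i)), y), b, fun i s => hb s i⟩

/-- Moving a variable to the other side preserves being ordered, unless some pattern relation for
this variable is ordered. -/
theorem OrderedRel.of_forall_not {R : X → Y → Z → Prop} (a : ℕ → X) (b : ℕ → Y) (c : ℕ → Z)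
    (habc : ∀ i j, R (a i) (b j) (c j) ↔ i < j)
    (hn : ∀ (n : ℕ) (j : Fin (n + 1)),
      ¬OrderedRel fun (x : Fin n → X) (y : Y) => ∃ z, ∀ i, R (x i) y z ↔ i.castSucc < j) :
    OrderedRel fun (x : X × Y) (z : Z) => R x.1 x.2 z := by
  intro n
  let D : Fin (n + 1) → (Fin n → X) → Y → Prop := fun j x y =>
    ∃ z, ∀ i, R (x i) y z ↔ i.castSucc < j
  -- In an increasing `(n + 1)`-tuple the entry at place `r` is used for `b` and the others for `a`;
  -- the colour records which cuts `j` are realizable for which places `r`.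
  obtain ⟨h, hh, k, hk⟩ := exists_strictMono_homogeneous (n + 1) fun e : Fin (n + 1) → ℕ =>
    {q : Fin (n + 1) × Fin (n + 1) | D q.2 (fun i => a (e (q.1.succAbove i))) (b (e q.1))}
  have hk' : ∀ (e : Fin (n + 1) → ℕ), StrictMono e → ∀ r j,
      (D j (fun i => a (h (e (r.succAbove i)))) (b (h (e r))) ↔ (r, j) ∈ k) := by
    intro e he r j
    rw [← hk e he]
    rfl
  have hdiag : ∀ j, (j, j) ∈ k := by
    intro j
    rw [← hk' (fun i => i) (fun i j hij => hij)]
    refine ⟨c (h j), fun i => ?_⟩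
    rw [habc, hh.lt_iff_lt]
    exact Fin.succAbove_lt_iff_castSucc_lt j i
  -- If moving the index of `b` past the `r`-th index of `a` changed realizability of the cut `j`,
  -- then that change would itself define arbitrarily long orders between `n`-tuples and single `y`,
  -- contrary to `hn`.
  have hadj : ∀ (j : Fin (n + 1)) (r : Fin n), (r.castSucc, j) ∈ k ↔ (r.succ, j) ∈ k := by
    intro j r
    by_contra hne
    have key : ∀ m : ℕ, ∃ (x : Fin m → Fin n → X) (y : Fin m → Y), ∀ i l,
        (i < l → (D j (x i) (y l) ↔ (r.succ, j) ∈ k)) ∧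
        (¬i < l → (D j (x i) (y l) ↔ (r.castSucc, j) ∈ k)) := by
      intro m
      -- Only the `r`-th entry depends on `i`. It is at the odd offset `2 * i + 1`, while the index
      -- of `b` is at the even offset `2 * l`, so the two never meet and their order expresses `i <
      -- l`. `e` lists both in increasing order.
      let pos : Fin m → Fin n → ℕ := fun i s =>
        if s < r then s else if s = r then r + 2 * i + 1 else s + 2 * m
      refine ⟨fun i s => a (h (pos i s)), fun l => b (h (r + 2 * l)), fun i l => ?_⟩
      let e : Fin (n + 1) → ℕ := fun s =>
        if (s : ℕ) < r then s else if (s : ℕ) = r then r + min (2 * (i : ℕ) + 1) (2 * (l : ℕ))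
          else if (s : ℕ) = r + 1 then r + max (2 * (i : ℕ) + 1) (2 * (l : ℕ)) else s - 1 + 2 * m
      have hi := i.2
      have hl := l.2
      have he : StrictMono e := by
        intro s s' hss'
        have : (s : ℕ) < s' := hss'
        simp only [e]
        split_ifs <;> omega
      constructor
      · intro hil
        have hil' : (i : ℕ) < l := hil
        have h1 : ∀ s, e (r.succ.succAbove s) = pos i s := by
          intro s
          simp only [e, pos, Fin.succAbove, Fin.lt_def, Fin.ext_iff]
          split_ifs <;> simp_all <;> omega
        have h2 : e r.succ = r + 2 * l := by
          simp only [e, Fin.val_succ]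
          split_ifs <;> omega
        have := hk' e he r.succ j
        simp only [h1, h2] at this
        exact this
      · intro hil
        have hil' : ¬(i : ℕ) < l := hil
        have h1 : ∀ s, e (r.castSucc.succAbove s) = pos i s := by
          intro s
          simp only [e, pos, Fin.succAbove, Fin.lt_def, Fin.ext_iff]
          split_ifs <;> simp_all <;> omega
        have h2 : e r.castSucc = r + 2 * l := by
          simp only [e, Fin.val_castSucc]
          split_ifs <;> omega
        have := hk' e he r.castSucc j
        simp only [h1, h2] at this
        exact this
    by_cases hs : (r.succ, j) ∈ k
    · have hc : (r.castSucc, j) ∉ k := fun hc => hne (iff_of_true hc hs)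
      refine hn n j fun m => ?_
      obtain ⟨x, y, hxy⟩ := key m
      refine ⟨x, y, fun i l => ?_⟩
      by_cases hil : i < l
      · exact iff_of_true (((hxy i l).1 hil).2 hs) hil
      · exact iff_of_false (fun hD => hc (((hxy i l).2 hil).1 hD)) hil
    · have hc : (r.castSucc, j) ∈ k := by_contra fun hc => hne (iff_of_false hc hs)
      refine hn n j (OrderedRel.of_not fun m => ?_)
      obtain ⟨x, y, hxy⟩ := key m
      refine ⟨x, y, fun i l => ?_⟩
      by_cases hil : i < l
      · exact iff_of_true (fun hD => hs (((hxy i l).1 hil).1 hD)) hil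
      · exact iff_of_false (fun hD => hD (((hxy i l).2 hil).2 hc)) hil
  have hzero : ∀ j r : Fin (n + 1), (r, j) ∈ k ↔ (0, j) ∈ k := by
    intro j r
    induction r using Fin.induction with
    | zero => rfl
    | succ r ih => rw [← hadj, ih]
  -- As the place of `b` is irrelevant, it can be put first: over the one parameter `b (h 0)` all
  -- cuts of the same `n` points are realizable.
  have hall : ∀ j, D j (fun i => a (h (i.succ : Fin (n + 1)))) (b (h 0)) := by
    intro j
    have := (hk' (fun i => i) (fun i j hij => hij) 0 j).2 ((hzero j j).1 (hdiag j))
    simpa using this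
  choose z hz using hall
  exact ⟨fun i => (a (h (i.succ : Fin (n + 1))), b (h 0)), fun j => z j.castSucc,
    fun i j => hz j.castSucc i⟩

end Rel

/-! ### Definable relations and sequences in saturated structures -/

namespace FirstOrder.Language

variable {L : Language.{u, v}} {M : Type w} [L.Structure M]

/-- A relation between tuples is definable without parameters. -/
def DefinableRel (L : Language.{u, v}) {M : Type w} [L.Structure M] {α β : Type*}
    (R : (α → M) → (β → M) → Prop) : Prop :=
  (∅ : Set M).Definable L {v : α ⊕ β → M | R (v ∘ Sum.inl) (v ∘ Sum.inr)}

theorem _root_.Set.Definable.setOf_iff {A : Set M} {α : Type*} {S : Set (α → M)}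
    (hS : A.Definable L S) (p : Prop) : A.Definable L {v | v ∈ S ↔ p} := by
  by_cases hp : p
  · simpa [hp] using hS
  · simp only [hp, iff_false]
    exact hS.compl

/-- Definability of the set of tuples for which some tuple realizes a prescribed finite pattern. -/
theorem _root_.Set.Definable.exists_forall_iff {A : Set M} {α β γ I : Type*} [Finite β] [Finite I]
    {S : Set (γ → M)} (hS : A.Definable L S) (f : I → γ → α ⊕ β) (p : I → Prop) :
    A.Definable L {v : α → M | ∃ u : β → M, ∀ i, Sum.elim v u ∘ f i ∈ S ↔ p i} := by
  have : A.Definable L (⋂ i, {v : α ⊕ β → M | v ∘ f i ∈ S ↔ p i}) :=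
    Set.definable_iInter_of_finite fun i =>
      Set.Definable.setOf_iff (S := {v : α ⊕ β → M | v ∘ f i ∈ S}) (hS.preimage_comp (f i)) (p i)
  convert this.exists_of_finite using 1
  ext v
  refine exists_congr fun u => Iff.trans ?_ Set.mem_iInter.symm
  rfl

theorem DefinableRel.swap {α β : Type*} {R : (α → M) → (β → M) → Prop} (hR : DefinableRel L R) :
    DefinableRel L fun y x => R x y := by
  have := hR.preimage_comp (Sum.swap : α ⊕ β → β ⊕ α)
  exact this

theorem DefinableRel.definable_pattern {α β I : Type*} [Finite β] [Finite I]
    {R : (α → M) → (β → M) → Prop} (hR : DefinableRel L R) (p : I → Prop) :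
    (∅ : Set M).Definable L
      {v : I × α → M | ∃ u, ∀ i, R (fun t => v (i, t)) u ↔ p i} := by
  have := hR.exists_forall_iff
    (fun i => Sum.elim (fun t => Sum.inl (i, t)) Sum.inr : I → α ⊕ β → (I × α) ⊕ β) p
  exact this

theorem DefinableRel.pattern {α I : Type*} [Finite I] {n : ℕ}
    {R : (α → M) → (Fin (n + 1) → M) → Prop} (hR : DefinableRel L R) (p : I → Prop) :
    DefinableRel L fun (x : I × α → M) (y : Fin 1 → M) =>
      ∃ z : Fin n → M, ∀ i, R (fun t => x (i, t)) (Fin.cons (y 0) z) ↔ p i := by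
  have := hR.exists_forall_iff
    (fun i => Sum.elim (fun t => Sum.inl (Sum.inl (i, t)))
      (Fin.cons (Sum.inl (Sum.inr 0)) Sum.inr) :
      I → α ⊕ Fin (n + 1) → ((I × α) ⊕ Fin 1) ⊕ Fin n) p
  unfold DefinableRel
  convert this using 1
  ext v
  refine exists_congr fun z => forall_congr' fun i => iff_congr (iff_of_eq ?_) Iff.rfl
  refine congrArg (R _) ?_
  funext k
  refine Fin.cases rfl (fun k => rfl) k

theorem DefinableRel.cons {α : Type*} {n : ℕ}
    {R : (α → M) → (Fin (n + 1) → M) → Prop} (hR : DefinableRel L R) :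
    DefinableRel L fun (x : α ⊕ Fin 1 → M) (z : Fin n → M) =>
      R (x ∘ Sum.inl) (Fin.cons (x (Sum.inr 0)) z) := by
  have := hR.preimage_comp (Sum.elim (fun t => Sum.inl (Sum.inl t))
      (Fin.cons (Sum.inl (Sum.inr 0)) Sum.inr) :
      α ⊕ Fin (n + 1) → (α ⊕ Fin 1) ⊕ Fin n)
  unfold DefinableRel
  convert this using 1
  ext v
  refine iff_of_eq (congrArg (R _) ?_)
  funext k
  refine Fin.cases rfl (fun k => rfl) k

variable [Nonempty M] {κ : Cardinal.{w}}

/-- A saturated structure contains sequences, along any small linear order, with all the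
parameter-free definable properties that increasing tuples of the given finite sequences share. -/
theorem IsSaturatedAt.exists_sequence (hκ : ℵ₀ ≤ κ) (h : IsSaturatedAt L M κ) {K : Type w}
    [LinearOrder K] (hK : #K < κ) {α : Type} [Finite α] (E : ∀ m : ℕ, Fin m → α → M) :
    ∃ a : K → α → M, ∀ (n : ℕ) (Q : Set (Fin n × α → M)), (∅ : Set M).Definable L Q →
      (∀ (m : ℕ) (f : Fin n → Fin m), StrictMono f → (fun q => E m (f q.1) q.2) ∈ Q) →
      ∀ f : Fin n → K, StrictMono f → (fun q => a (f q.1) q.2) ∈ Q := by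
  classical
  let J := Σ n : ℕ, {Q : Set (Fin n × α → M) // (∅ : Set M).Definable L Q ∧
    ∀ (m : ℕ) (f : Fin n → Fin m), StrictMono f → (fun q => E m (f q.1) q.2) ∈ Q} ×
      {f : Fin n → K // StrictMono f}
  have hKα : #(K × α) < κ := by
    rw [Cardinal.mk_prod]
    refine Cardinal.mul_lt_of_lt hκ (by simpa using hK) ?_
    exact (Cardinal.lift_lt_aleph0.2 (Cardinal.lt_aleph0_of_finite α)).trans_le hκ
  obtain ⟨v, hv⟩ := h.exists_solution hκ hKα (A := ∅)
    (by simpa using Cardinal.aleph0_pos.trans_le hκ) (J := J)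
    (V := fun j => Fin j.1 × α) (fun j => j.2.1.1) (fun j => j.2.1.2.1)
    (fun j q => (j.2.2.1 q.1, q.2)) (by
      intro s
      -- Finitely many conditions mention finitely many places of `K`; the given finite sequence of
      -- length `#U` is laid along them.
      let U : Finset K := s.biUnion fun j => Finset.univ.image j.2.2.1
      let o := U.orderIsoOfFin rfl
      have hU : ∀ j ∈ s, ∀ i, j.2.2.1 i ∈ U := fun j hj i =>
        Finset.mem_biUnion.2 ⟨j, hj, Finset.mem_image_of_mem _ (Finset.mem_univ i)⟩
      refine ⟨fun q => if hq : q.1 ∈ U then E _ (o.symm ⟨q.1, hq⟩) q.2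
        else Classical.arbitrary M, fun j hj => ?_⟩
      have := j.2.1.2.2 _ (fun i => o.symm ⟨j.2.2.1 i, hU j hj i⟩)
        fun i i' hii' => o.symm.strictMono (j.2.2.2 hii')
      convert this using 1
      funext q
      simp only [Function.comp_apply, hU j hj q.1, dite_true])
  exact ⟨fun k t => v (k, t), fun n Q hQ hE f hf => hv ⟨n, ⟨Q, hQ, hE⟩, ⟨f, hf⟩⟩⟩

/-- In a saturated structure, a finitely realized pattern over few tuples is realized. -/
theorem IsSaturatedAt.exists_tuple (hκ : ℵ₀ ≤ κ) (h : IsSaturatedAt L M κ) {J : Type w}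
    (hJ : #J < κ) {α β : Type} [Finite α] [Finite β] {R : (α → M) → (β → M) → Prop}
    (hR : DefinableRel L R) (a : J → α → M) (p : J → Prop)
    (hfin : ∀ s : Finset J, ∃ b, ∀ j ∈ s, R (a j) b ↔ p j) :
    ∃ b, ∀ j, R (a j) b ↔ p j := by
  let A : Set M := Set.range fun q : J × α => a q.1 q.2
  have hA : #A < κ := by
    refine Cardinal.mk_range_le.trans_lt ?_
    rw [Cardinal.mk_prod]
    refine Cardinal.mul_lt_of_lt hκ (by simpa using hJ) ?_
    exact (Cardinal.lift_lt_aleph0.2 (Cardinal.lt_aleph0_of_finite α)).trans_le hκ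
  have hβ : #(ULift.{w} β) < κ := (Cardinal.lt_aleph0_of_finite _).trans_le hκ
  have hdef : ∀ j, A.Definable L {b : β → M | R (a j) b ↔ p j} := by
    intro j
    have h1 : A.Definable L (⋂ t : α, {v : β ⊕ α → M | v (Sum.inr t) = a j t}) := by
      refine Set.definable_iInter_of_finite fun t => ?_
      have := Set.Definable.singleton_of_mem (L := L) (A := A) (a := a j t) ⟨(j, t), rfl⟩
      exact Set.Definable.preimage_comp (fun _ => (Sum.inr t : β ⊕ α)) this
    have h2 : A.Definable L {v : β ⊕ α → M | R (v ∘ Sum.inr) (v ∘ Sum.inl)} :=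
      Set.Definable.mono hR.swap (Set.empty_subset A)
    refine Set.Definable.setOf_iff (S := {b : β → M | R (a j) b}) ?_ (p j)
    convert (h1.inter h2).exists_of_finite using 1
    ext b
    constructor
    · exact fun hb => ⟨a j, Set.mem_iInter.2 fun t => rfl, hb⟩
    · rintro ⟨u, hu1, hu2⟩
      have : u = a j := funext fun t => Set.mem_iInter.1 hu1 t
      subst this
      exact hu2
  obtain ⟨v, hv⟩ := h.exists_solution hκ hβ hA (V := fun _ : J => β)
    (fun j => {b : β → M | R (a j) b ↔ p j}) hdef (fun _ => ULift.up) (by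
      intro s
      obtain ⟨b, hb⟩ := hfin s
      exact ⟨fun t => b t.down, hb⟩)
  exact ⟨_, hv⟩

/-- Realizability of a fixed finite pattern is a definable property of a tuple, and it holds for all
increasing tuples of the finite shattered families. It therefore passes to the sequence along `K`,
and saturation then realizes infinite patterns. -/
theorem IsSaturatedAt.exists_shattered (hκ : ℵ₀ ≤ κ) (h : IsSaturatedAt L M κ) {K : Type w}
    [LinearOrder K] (hK : #K < κ) {α β : Type} [Finite α] [Finite β]
    {R : (α → M) → (β → M) → Prop} (hR : DefinableRel L R) (hind : IndependentRel R) :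
    ∃ a : K → α → M, ∀ S : Set K, ∃ b, ∀ i, R (a i) b ↔ i ∈ S := by
  choose E b hEb using hind
  obtain ⟨a, ha⟩ := h.exists_sequence hκ hK E
  refine ⟨a, fun S => h.exists_tuple hκ hK hR a (· ∈ S) fun s => ?_⟩
  let f := s.orderEmbOfFin rfl
  obtain ⟨c, hc⟩ := ha _ _ (hR.definable_pattern fun i => f i ∈ S) (by
    intro m g hg
    refine ⟨b m (g '' {i | f i ∈ S}), fun i => ?_⟩
    refine (hEb m (g i) _).trans ?_
    exact hg.injective.mem_set_image) f f.strictMono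
  refine ⟨c, fun j hj => ?_⟩
  obtain ⟨i, rfl⟩ : j ∈ Set.range f := by
    rw [Finset.range_orderEmbOfFin]
    exact hj
  exact hc i

/-- Both sequences are stretched together as one sequence of concatenated tuples. The last clause
keeps further definable properties of the first sequence, such as homogeneity. -/
theorem IsSaturatedAt.exists_ordered (hκ : ℵ₀ ≤ κ) (h : IsSaturatedAt L M κ) {K : Type w}
    [LinearOrder K] (hK : #K < κ) {α β : Type} [Finite α] [Finite β]
    {R : (α → M) → (β → M) → Prop} (hR : DefinableRel L R)
    (E : ∀ m : ℕ, Fin m → α → M) (E' : ∀ m : ℕ, Fin m → β → M)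
    (hE : ∀ m i j, R (E m i) (E' m j) ↔ i < j) :
    ∃ (a : K → α → M) (b : K → β → M), (∀ i j, R (a i) (b j) ↔ i < j) ∧
      ∀ (n : ℕ) (Q : Set (Fin n × α → M)), (∅ : Set M).Definable L Q →
      (∀ (m : ℕ) (f : Fin n → Fin m), StrictMono f → (fun q => E m (f q.1) q.2) ∈ Q) →
      ∀ f : Fin n → K, StrictMono f → (fun q => a (f q.1) q.2) ∈ Q := by
  obtain ⟨c, hc⟩ := h.exists_sequence hκ hK (α := α ⊕ β)
    fun m i => Sum.elim (E m i) (E' m i)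
  have hdef : ∀ (n : ℕ) (i j : Fin n), (∅ : Set M).Definable L
      {v : Fin n × (α ⊕ β) → M | R (fun t => v (i, Sum.inl t)) (fun t => v (j, Sum.inr t))} := by
    intro n i j
    exact hR.preimage_comp (Sum.elim (fun t => (i, Sum.inl t)) fun t => (j, Sum.inr t) :
      α ⊕ β → Fin n × (α ⊕ β))
  refine ⟨fun k t => c k (Sum.inl t), fun k t => c k (Sum.inr t), fun i j => ?_, ?_⟩
  · rcases lt_trichotomy i j with hij | rfl | hij
    · have := hc 2 _ (hdef 2 0 1) (fun m f hf => (hE m (f 0) (f 1)).2 (hf Fin.zero_lt_one))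
        ![i, j] (by simpa [Fin.strictMono_iff_lt_succ] using hij)
      exact iff_of_true this hij
    · have := hc 1 _ (hdef 1 0 0).compl (fun m f hf => fun h' =>
        lt_irrefl _ ((hE m (f 0) (f 0)).1 h')) ![i] (Subsingleton.strictMono _)
      exact iff_of_false this (lt_irrefl _)
    · have := hc 2 _ (hdef 2 1 0).compl (fun m f hf => fun h' =>
        lt_asymm (hf Fin.zero_lt_one) ((hE m (f 1) (f 0)).1 h'))
        ![j, i] (by simpa [Fin.strictMono_iff_lt_succ] using hij)
      exact iff_of_false this (lt_asymm hij)
  · intro n Q hQ hEQ f hf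
    exact hc n _ (hQ.preimage_comp fun q : Fin n × α => (q.1, (Sum.inl q.2 : α ⊕ β))) hEQ f hf

/-- In an `ℵ₁`-saturated structure, an independent definable relation yields one in which the
second argument is a single element. -/
theorem IsSaturatedAt.exists_independentRel_single (hκ : ℵ₀ < κ) (h : IsSaturatedAt L M κ)
    (n : ℕ) : ∀ {α : Type} [Finite α] (R : (α → M) → (Fin n → M) → Prop), DefinableRel L R →
      IndependentRel R → ∃ (γ : Type) (_ : Finite γ) (S : (γ → M) → (Fin 1 → M) → Prop),
        DefinableRel L S ∧ IndependentRel S := by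
  induction n with
  | zero =>
    intro α _ R _ hR
    obtain ⟨a, b, hab⟩ := hR 1
    have h1 := (hab 0 Set.univ).2 (Set.mem_univ _)
    rw [Subsingleton.elim (b Set.univ) (b ∅)] at h1
    exact ((hab 0 ∅).1 h1).elim
  | succ n ih =>
    intro α _ R hR hind
    by_contra hcon
    obtain ⟨a, ha⟩ := h.exists_shattered hκ.le (K := ULift.{w} ℕ) (by simpa using hκ) hR hind
    -- If a pattern relation for the first coordinate is independent, then its second argument is
    -- already single; otherwise that coordinate moves to the first argument and the remaining tuple
    -- is shorter.
    have key := IndependentRel.of_forall_not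
      (R := fun (x : α → M) (y : Fin 1 → M) (z : Fin n → M) => R x (Fin.cons (y 0) z))
      (fun i => a ⟨i⟩) (by
        intro S
        obtain ⟨b, hb⟩ := ha {i | i.down ∈ S}
        refine ⟨fun _ => b 0, Fin.tail b, fun i => ?_⟩
        rw [Fin.cons_self_tail]
        exact hb ⟨i⟩) (by
        intro m s hs
        refine hcon ⟨Fin m × α, inferInstance, _, hR.pattern (· ∈ s), fun N => ?_⟩
        obtain ⟨x, y, hxy⟩ := hs N
        exact ⟨fun i q => x i q.1 q.2, y, hxy⟩)
    refine hcon (ih _ hR.cons fun N => ?_)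
    obtain ⟨x, z, hxz⟩ := key N
    exact ⟨fun i => Sum.elim (x i).1 (x i).2, z, hxz⟩

/-- In an `ℵ₁`-saturated structure, an ordered definable relation yields one in which the
second argument is a single element. -/
theorem IsSaturatedAt.exists_orderedRel_single (hκ : ℵ₀ < κ) (h : IsSaturatedAt L M κ)
    (n : ℕ) : ∀ {α : Type} [Finite α] (R : (α → M) → (Fin n → M) → Prop), DefinableRel L R →
      OrderedRel R → ∃ (γ : Type) (_ : Finite γ) (S : (γ → M) → (Fin 1 → M) → Prop),
        DefinableRel L S ∧ OrderedRel S := by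
  induction n with
  | zero =>
    intro α _ R _ hR
    obtain ⟨a, b, hab⟩ := hR 2
    have h1 := (hab 0 1).2 Fin.zero_lt_one
    rw [Subsingleton.elim (b 1) (b 0)] at h1
    exact (lt_irrefl _ ((hab 0 0).1 h1)).elim
  | succ n ih =>
    intro α _ R hR hord
    by_contra hcon
    choose E E' hE using hord
    obtain ⟨a, b, hab, -⟩ := h.exists_ordered hκ.le (K := ULift.{w} ℕ) (by simpa using hκ) hR
      E E' hE
    have key := OrderedRel.of_forall_not
      (R := fun (x : α → M) (y : Fin 1 → M) (z : Fin n → M) => R x (Fin.cons (y 0) z))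
      (fun i => a ⟨i⟩) (fun i _ => b ⟨i⟩ 0) (fun i => Fin.tail (b ⟨i⟩)) (by
        intro i j
        rw [Fin.cons_self_tail]
        exact hab _ _) (by
        intro m j hs
        refine hcon ⟨Fin m × α, inferInstance, _, hR.pattern (fun i : Fin m => i.castSucc < j),
          fun N => ?_⟩
        obtain ⟨x, y, hxy⟩ := hs N
        exact ⟨fun i q => x i q.1 q.2, y, hxy⟩)
    refine hcon (ih _ hR.cons fun N => ?_)
    obtain ⟨x, z, hxz⟩ := key N
    exact ⟨fun i => Sum.elim (x i).1 (x i).2, z, hxz⟩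

end FirstOrder.Language

/-! ### Transfer between models, and instances of formulas in types -/

namespace FirstOrder.Language

section Transfer

variable {L : Language.{u, v}} {T : L.Theory}

open Classical in
/-- The sentence asserting that some finite tuple realizes a given pattern of instances of `φ`. -/
noncomputable def patternSentence {Γ δ I : Type} [Finite Γ] [Finite I] (φ : L.Formula δ)
    (f : I → δ → Γ) (p : I → Prop) : L.Sentence :=
  Formula.iExs Γ (Formula.iInf fun i => if p i then φ.relabel (Sum.inr ∘ f i : δ → Empty ⊕ Γ)
    else (φ.relabel (Sum.inr ∘ f i : δ → Empty ⊕ Γ)).not)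

theorem realize_patternSentence {Γ δ I : Type} [Finite Γ] [Finite I] (φ : L.Formula δ)
    (f : I → δ → Γ) (p : I → Prop) (N : Type*) [L.Structure N] :
    N ⊨ patternSentence φ f p ↔ ∃ x : Γ → N, ∀ i, φ.Realize (x ∘ f i) ↔ p i := by
  simp only [patternSentence, Sentence.Realize, Formula.realize_iExs, Formula.realize_iInf]
  refine exists_congr fun x => forall_congr' fun i => ?_
  by_cases hp : p i <;> simp [hp, Formula.realize_relabel, ← Function.comp_assoc]

/-- A finite pattern of instances is expressed by one existential sentence, whose truth a complete
theory decides. This allows independence and order to be tested in the given model. -/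
theorem Theory.IsComplete.exists_pattern_iff (hT : T.IsComplete) (M N : Type*) [L.Structure M]
    [L.Structure N] [M ⊨ T] [N ⊨ T] [Nonempty M] [Nonempty N] {Γ δ I : Type} [Finite Γ]
    [Finite I] (φ : L.Formula δ) (f : I → δ → Γ) (p : I → Prop) :
    (∃ x : Γ → M, ∀ i, φ.Realize (x ∘ f i) ↔ p i) ↔
      ∃ x : Γ → N, ∀ i, φ.Realize (x ∘ f i) ↔ p i := by
  rw [← realize_patternSentence, ← realize_patternSentence, hT.realize_sentence_iff,
    hT.realize_sentence_iff]

theorem exists_shattered_iff_pattern (N : Type*) [L.Structure N] {k m : ℕ}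
    (φ : L.Formula (Fin k ⊕ Fin m)) (n : ℕ) :
    (∃ (a : Fin n → Fin m → N) (b : Set (Fin n) → Fin k → N), ∀ i s,
      φ.Realize (Sum.elim (b s) (a i)) ↔ i ∈ s) ↔
    ∃ x : (Set (Fin n) × Fin k) ⊕ (Fin n × Fin m) → N, ∀ q : Fin n × Set (Fin n),
      φ.Realize (x ∘ Sum.map (fun t => (q.2, t)) fun t => (q.1, t)) ↔ q.1 ∈ q.2 := by
  constructor
  · rintro ⟨a, b, hab⟩
    refine ⟨Sum.elim (fun q => b q.1 q.2) fun q => a q.1 q.2, fun q => ?_⟩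
    rw [← hab, Sum.elim_comp_map]
    rfl
  · rintro ⟨x, hx⟩
    refine ⟨fun i t => x (Sum.inr (i, t)), fun s t => x (Sum.inl (s, t)), fun i s => ?_⟩
    rw [← hx (i, s)]
    refine iff_of_eq (congrArg φ.Realize ?_)
    funext t
    rcases t with t | t <;> rfl

theorem exists_ordered_iff_pattern (N : Type*) [L.Structure N] {k m : ℕ}
    (φ : L.Formula (Fin k ⊕ Fin m)) (n : ℕ) :
    (∃ (a : Fin n → Fin k → N) (b : Fin n → Fin m → N), ∀ i j,
      φ.Realize (Sum.elim (a i) (b j)) ↔ i < j) ↔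
    ∃ x : (Fin n × Fin k) ⊕ (Fin n × Fin m) → N, ∀ q : Fin n × Fin n,
      φ.Realize (x ∘ Sum.map (fun t => (q.1, t)) fun t => (q.2, t)) ↔ q.1 < q.2 := by
  constructor
  · rintro ⟨a, b, hab⟩
    refine ⟨Sum.elim (fun q => a q.1 q.2) fun q => b q.1 q.2, fun q => ?_⟩
    rw [← hab, Sum.elim_comp_map]
    rfl
  · rintro ⟨x, hx⟩
    refine ⟨fun i t => x (Sum.inl (i, t)), fun s t => x (Sum.inr (s, t)), fun i j => ?_⟩
    rw [← hx (i, j)]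
    refine iff_of_eq (congrArg φ.Realize ?_)
    funext t
    rcases t with t | t <;> rfl

theorem Theory.IsComplete.hasIndependenceProperty_iff (hT : T.IsComplete) (M : Type*)
    [L.Structure M] [M ⊨ T] [Nonempty M] {k m : ℕ} (φ : L.Formula (Fin k ⊕ Fin m)) :
    T.HasIndependenceProperty φ ↔
      IndependentRel fun (a : Fin m → M) (b : Fin k → M) => φ.Realize (Sum.elim b a) := by
  refine forall_congr' fun n => _root_.Iff.trans ⟨?_, fun h => ⟨hT.1.some, ?_⟩⟩
    (exists_shattered_iff_pattern M φ n).symm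
  · rintro ⟨N, h⟩
    exact (hT.exists_pattern_iff N M _ _ _).1 ((exists_shattered_iff_pattern N φ n).1 h)
  · exact (exists_shattered_iff_pattern _ φ n).2 ((hT.exists_pattern_iff M _ _ _ _).1 h)

theorem Theory.IsComplete.hasOrderProperty_iff (hT : T.IsComplete) (M : Type*)
    [L.Structure M] [M ⊨ T] [Nonempty M] {k m : ℕ} (φ : L.Formula (Fin k ⊕ Fin m)) :
    T.HasOrderProperty φ ↔
      OrderedRel fun (a : Fin k → M) (b : Fin m → M) => φ.Realize (Sum.elim a b) := by
  refine forall_congr' fun n => _root_.Iff.trans ⟨?_, fun h => ⟨hT.1.some, ?_⟩⟩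
    (exists_ordered_iff_pattern M φ n).symm
  · rintro ⟨N, h⟩
    exact (hT.exists_pattern_iff N M _ _ _).1 ((exists_ordered_iff_pattern N φ n).1 h)
  · exact (exists_ordered_iff_pattern _ φ n).2 ((hT.exists_pattern_iff M _ _ _ _).1 h)

theorem definableRel_realize {M : Type*} [L.Structure M] {α β : Type*} (φ : L.Formula (α ⊕ β)) :
    DefinableRel L fun (a : α → M) (b : β → M) => φ.Realize (Sum.elim a b) := by
  refine Set.empty_definable_iff.2 ⟨φ, ?_⟩
  ext x
  exact iff_of_eq (congrArg φ.Realize (Sum.elim_comp_inl_inr x))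

theorem DefinableRel.exists_formula {M : Type*} [L.Structure M] {α β : Type*}
    {R : (α → M) → (β → M) → Prop} (hR : DefinableRel L R) :
    ∃ φ : L.Formula (α ⊕ β), ∀ a b, φ.Realize (Sum.elim a b) ↔ R a b := by
  obtain ⟨φ, hφ⟩ := Set.empty_definable_iff.1 hR
  exact ⟨φ, fun a b => (Set.ext_iff.1 hφ (Sum.elim a b)).symm⟩

theorem Theory.IsDependent.not_independentRel (hT : T.IsComplete) (hdep : T.IsDependent)
    {M : Type*} [L.Structure M] [M ⊨ T] [Nonempty M] {α β : Type} [Finite α] [Finite β]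
    {R : (α → M) → (β → M) → Prop} (hR : DefinableRel L R) : ¬IndependentRel R := by
  intro hind
  obtain ⟨φ, hφ⟩ := hR.swap.exists_formula
  obtain ⟨m, ⟨e⟩⟩ := Finite.exists_equiv_fin α
  obtain ⟨k, ⟨e'⟩⟩ := Finite.exists_equiv_fin β
  refine hdep ⟨k, m, φ.relabel (Sum.map e' e), ?_⟩
  rw [hT.hasIndependenceProperty_iff M]
  intro n
  obtain ⟨a, b, hab⟩ := hind n
  refine ⟨fun i => a i ∘ e.symm, fun s => b s ∘ e'.symm, fun i s => ?_⟩
  refine _root_.Iff.trans ?_ (hab i s)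
  change (φ.relabel (Sum.map e' e)).Realize (Sum.elim (b s ∘ e'.symm) (a i ∘ e.symm)) ↔ _
  rw [Formula.realize_relabel, Sum.elim_comp_map, Function.comp_assoc, Function.comp_assoc,
    e.symm_comp_self, e'.symm_comp_self, Function.comp_id, Function.comp_id, hφ]

end Transfer

section Instances

variable {L : Language.{u, v}} {M : Type w}

theorem LHom.onTerm_subst {L₁ L₂ : Language} (g : L₁ →ᴸ L₂)
    {α β : Type*} (tf : α → L₁.Term β) (t : L₁.Term α) :
    g.onTerm (t.subst tf) = (g.onTerm t).subst fun a => g.onTerm (tf a) := by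
  induction t with
  | var a => rfl
  | func f ts ih => simp [LHom.onTerm, Term.subst, ih]

theorem LHom.onTerm_relabel {L₁ L₂ : Language} (g : L₁ →ᴸ L₂)
    {α β : Type*} (h : α → β) (t : L₁.Term α) :
    g.onTerm (t.relabel h) = (g.onTerm t).relabel h := by
  induction t with
  | var a => rfl
  | func f ts ih => simp [LHom.onTerm, Term.relabel, ih]

theorem LHom.onBoundedFormula_subst {L₁ L₂ : Language}
    (g : L₁ →ᴸ L₂) {α β : Type*} {n : ℕ} (φ : L₁.BoundedFormula α n) (tf : α → L₁.Term β) :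
    g.onBoundedFormula (φ.subst tf) =
      (g.onBoundedFormula φ).subst fun a => g.onTerm (tf a) := by
  have ht : ∀ (n : ℕ) (t : L₁.Term (α ⊕ Fin n)),
      g.onTerm (t.subst (Sum.elim (Term.relabel Sum.inl ∘ tf) (Term.var ∘ Sum.inr))) =
        (g.onTerm t).subst (Sum.elim (Term.relabel Sum.inl ∘ fun a => g.onTerm (tf a))
          (Term.var ∘ Sum.inr)) := by
    intro n t
    rw [LHom.onTerm_subst]
    congr 1
    funext a
    rcases a with a | a
    · exact LHom.onTerm_relabel g _ _
    · rfl
  unfold BoundedFormula.subst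
  induction φ with
  | falsum => rfl
  | equal t₁ t₂ =>
    simp only [BoundedFormula.mapTermRel, LHom.onBoundedFormula]
    exact congrArg₂ BoundedFormula.equal (ht _ t₁) (ht _ t₂)
  | rel R ts =>
    simp only [BoundedFormula.mapTermRel, LHom.onBoundedFormula]
    exact congrArg (BoundedFormula.rel _) (funext fun i => ht _ (ts i))
  | imp φ ψ ih₁ ih₂ =>
    simp only [BoundedFormula.mapTermRel, LHom.onBoundedFormula, ih₁, ih₂]
  | all φ ih =>
    simp only [BoundedFormula.mapTermRel, LHom.onBoundedFormula]
    exact congrArg _ ih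

/-- The formula `φ(x, b)` with parameters `b` from `M`, as a sentence with constants. -/
def instParams {β : Type*} (φ : L.Formula (Fin 1 ⊕ β)) (b : β → M) :
    L[[M]][[Fin 1]].Sentence :=
  BoundedFormula.subst ((L[[M]].lhomWithConstants (Fin 1)).onFormula
      ((L.lhomWithConstants M).onFormula φ))
    (Sum.elim (fun i => (L[[M]].con i).term)
      fun j => Constants.term (L := L[[M]][[Fin 1]])
        ((L[[M]].lhomWithConstants (Fin 1)).onFunction (L.con (b j) : L[[M]].Constants)))

/-- This connects the sentence-level definition of conjugacy with the action of automorphisms on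
parameter tuples. -/
theorem mapParams_instParams {β : Type*} (f : M → M) (φ : L.Formula (Fin 1 ⊕ β)) (b : β → M) :
    mapParams f (instParams φ b) = instParams φ (f ∘ b) := by
  have h : ((L.lhomWithConstantsMap f).addConstants (Fin 1)).comp
      ((L[[M]].lhomWithConstants (Fin 1)).comp (L.lhomWithConstants M)) =
        (L[[M]].lhomWithConstants (Fin 1)).comp (L.lhomWithConstants M) := by
    ext n x <;> rfl
  have hc : ∀ ψ : L.Formula (Fin 1 ⊕ β), (L[[M]].lhomWithConstants (Fin 1)).onFormula
      ((L.lhomWithConstants M).onFormula ψ) =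
        ((L[[M]].lhomWithConstants (Fin 1)).comp (L.lhomWithConstants M)).onBoundedFormula ψ :=
    fun ψ => by rw [LHom.comp_onBoundedFormula]; rfl
  unfold mapParams instParams LHom.onSentence
  rw [hc]
  change LHom.onBoundedFormula _ (BoundedFormula.subst _ _) = _
  rw [LHom.onBoundedFormula_subst]
  congr 1
  · conv_rhs => rw [← h, LHom.comp_onBoundedFormula]
    rfl
  · funext a
    rcases a with a | a
    · exact congrArg (Term.func (L := L[[M]][[Fin 1]]) _) (funext fun i => i.elim0)
    · exact congrArg (Term.func (L := L[[M]][[Fin 1]]) _) (funext fun i => i.elim0)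

variable [L.Structure M]

theorem instParams_mem_typeOf [Nonempty M] {β : Type*} (φ : L.Formula (Fin 1 ⊕ β)) (b : β → M)
    (x : Fin 1 → M) :
    instParams φ b ∈ (L.elementaryDiagram M).typeOf x ↔ φ.Realize (Sum.elim x b) := by
  rw [Theory.CompleteType.mem_typeOf, Formula.realize_equivSentence_symm]
  let _ := constantsOn.structure x
  unfold instParams Sentence.Realize Formula.Realize
  rw [BoundedFormula.realize_subst]
  unfold LHom.onFormula
  rw [LHom.realize_onBoundedFormula, LHom.realize_onBoundedFormula]
  refine iff_of_eq (congrArg (fun y => BoundedFormula.Realize φ y _) ?_)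
  funext a
  rcases a with a | a
  · rw [Subsingleton.elim a 0]
    exact Term.realize_constants (L := L[[M]][[Fin 1]])
  · exact Term.realize_constants (L := L[[M]][[Fin 1]])

/-- The form in which conjugacy is used below. The converse implication rests on injectivity of
`mapParams g`, with inverse `mapParams g.symm`. -/
theorem Conjugate.instParams_mem_iff {p q : OneTypes L M} (h : Conjugate p q) :
    ∃ g : M ≃[L] M, ∀ {β : Type} (φ : L.Formula (Fin 1 ⊕ β)) (b : β → M),
      instParams φ b ∈ p ↔ instParams φ (g ∘ b) ∈ q := by
  obtain ⟨g, hg⟩ := h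
  have hinj : Function.Injective (mapParams (L := L) g) := by
    refine Function.LeftInverse.injective (g := mapParams (L := L) g.symm) fun σ => ?_
    have h : ((g.symm : M ≃[L] M) : M → M) ∘ g = id := by
      funext x
      exact g.symm_apply_apply x
    rw [← Function.comp_apply (f := mapParams (L := L) g.symm), ← mapParams_comp, h, mapParams_id]
    rfl
  refine ⟨g, fun φ b => ?_⟩
  rw [← mapParams_instParams, ← SetLike.mem_coe (p := q), hg, hinj.mem_set_image]
  rfl

end Instances

end FirstOrder.Language

/-! ### The independent case -/

namespace FirstOrder.Language

section

variable {L : Language.{u, v}} {M : Type w} [L.Structure M]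

/-- A type is a set of sentences in a language with at most `lam` symbols. -/
theorem mk_oneTypes_le {lam : Cardinal.{w}} (hM : #M = lam)
    (hL : Cardinal.lift.{w} (max ℵ₀ L.card) < Cardinal.lift.{max u v} lam) :
    #(OneTypes L M) ≤ Cardinal.lift.{max u v} (2 ^ lam) := by
  have hlam : (ℵ₀ : Cardinal.{max u v w}) ≤ Cardinal.lift.{max u v} lam := by
    refine le_trans ?_ hL.le
    simp
  have hcard : L[[M]][[Fin 1]].card ≤ Cardinal.lift.{max u v} lam := by
    rw [card_withConstants, card_withConstants, hM]
    simp only [Cardinal.lift_add, Cardinal.lift_lift, Cardinal.mk_fin, Cardinal.lift_natCast]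
    refine Cardinal.add_le_of_le hlam (Cardinal.add_le_of_le hlam ?_ ?_) ?_
    · refine le_trans ?_ hL.le
      simp
    · simp
    · simpa using Cardinal.one_le_aleph0.trans hlam
  have hsent : #(L[[M]][[Fin 1]].Sentence) ≤ Cardinal.lift.{max u v} lam := by
    have h1 : #(L[[M]][[Fin 1]].Sentence) ≤
        #(Σ n, L[[M]][[Fin 1]].BoundedFormula Empty n) :=
      Cardinal.mk_le_of_injective (f := fun σ => ⟨0, σ⟩) fun σ τ h => by simpa using h
    refine h1.trans (BoundedFormula.card_le.trans (max_le hlam ?_))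
    simpa using hcard
  calc #(OneTypes L M) ≤ #(Set (L[[M]][[Fin 1]].Sentence)) :=
        Cardinal.mk_le_of_injective
          (SetLike.coe_injective : Function.Injective
            fun p : OneTypes L M => (p : Set L[[M]][[Fin 1]].Sentence))
    _ = 2 ^ #(L[[M]][[Fin 1]].Sentence) := Cardinal.mk_set
    _ ≤ 2 ^ Cardinal.lift.{max u v} lam := Cardinal.power_le_power_left two_ne_zero hsent
    _ = Cardinal.lift.{max u v} (2 ^ lam) := by simp

variable [Nonempty M]

theorem instParams_mem_averageType {ι β : Type*} (D : Ultrafilter ι) (c : ι → M)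
    (φ : L.Formula (Fin 1 ⊕ β)) (b : β → M) :
    instParams φ b ∈ (L.elementaryDiagram M).averageType D c ↔
      ∀ᶠ i in D, φ.Realize (Sum.elim (fun _ => c i) b) := by
  simp only [Theory.mem_averageType, instParams_mem_typeOf]

/-- An automorphism moving the average of `c` along `D` to the average along `D'`, and one moving it
to the average along `D''`, agree on a shattered family `c` only if `D' = D''`. -/
theorem eq_of_conjugate_averageType {ι : Type*} {β : Type} {c : ι → M}
    {φ : L.Formula (Fin 1 ⊕ β)}
    (hc : ∀ S : Set ι, ∃ b, ∀ i, φ.Realize (Sum.elim (fun _ => c i) b) ↔ i ∈ S)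
    {p : OneTypes L M} {D D' : Ultrafilter ι} {g g' : M ≃[L] M}
    (hg : ∀ b : β → M, instParams φ b ∈ (L.elementaryDiagram M).averageType D c ↔
      instParams φ (g ∘ b) ∈ p)
    (hg' : ∀ b : β → M, instParams φ b ∈ (L.elementaryDiagram M).averageType D' c ↔
      instParams φ (g' ∘ b) ∈ p)
    (hgg' : g ∘ c = g' ∘ c) : D = D' := by
  refine (Ultrafilter.coe_le_coe.1 fun S hS => ?_).symm
  obtain ⟨b, hb⟩ := hc S
  have h1 : instParams φ b ∈ (L.elementaryDiagram M).averageType D c := by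
    rw [instParams_mem_averageType]
    filter_upwards [hS] with i hi using (hb i).2 hi
  -- The parameter `g'.symm ∘ g ∘ b` cuts out the same set `S` on `c` as `b` does, because `g` and
  -- `g'` agree on `c`. Membership of `S` thus passes through `p` from `D` to `D'`.
  have h2 : g' ∘ (g'.symm ∘ g ∘ b) = g ∘ b := by
    funext t
    exact g'.apply_symm_apply _
  rw [hg, ← h2, ← hg', instParams_mem_averageType] at h1
  filter_upwards [h1] with i hi
  rw [← hb i, ← StrongHomClass.realize_formula g]
  rw [← StrongHomClass.realize_formula g'] at hi
  have h3 : ∀ (f : M ≃[L] M) (y : β → M), f ∘ Sum.elim (fun _ : Fin 1 => c i) y =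
      Sum.elim (fun _ => (f ∘ c) i) (f ∘ y) := by
    intro f y
    rw [Sum.comp_elim]
    rfl
  rw [h3, h2, ← hgg'] at hi
  rw [h3]
  exact hi

theorem Theory.aleph0_lt_of_size_lt {T : L.Theory} {lam : Cardinal.{w}}
    (hL : Cardinal.lift.{w} T.size < Cardinal.lift.{max u v} lam) : ℵ₀ < lam := by
  have h1 : (ℵ₀ : Cardinal.{max u v w}) ≤ Cardinal.lift.{w} T.size := by
    simp [Theory.size]
  simpa using h1.trans_lt hL

theorem Theory.IsIndependent.numTypesUpToConj_eq {T : L.Theory} [M ⊨ T] (hT : T.IsComplete)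
    (hind : T.IsIndependent) {lam mu : Cardinal.{w}} (hM : #M = lam) (hsat : L.IsSaturated M)
    (hpow : lam ^< lam = lam) (hmu : lam = 2 ^ mu)
    (hL : Cardinal.lift.{w} T.size < Cardinal.lift.{max u v} lam) :
    L.numTypesUpToConj M = Cardinal.lift.{max u v} (2 ^ lam) := by
  have hlam : ℵ₀ < lam := Theory.aleph0_lt_of_size_lt hL
  have hsat' : IsSaturatedAt L M lam := hM ▸ hsat
  refine le_antisymm (Cardinal.mk_quotient_le.trans (mk_oneTypes_le hM hL)) ?_
  have hmulam : mu < lam := hmu ▸ Cardinal.cantor mu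
  obtain ⟨k, m, φ, hφ⟩ := hind
  rw [hT.hasIndependenceProperty_iff M] at hφ
  obtain ⟨γ, _, S, hS, hSind⟩ := hsat'.exists_independentRel_single hlam k _
    (definableRel_realize φ).swap hφ
  obtain ⟨ψ, hψ⟩ := hS.swap.exists_formula
  let K := mu.ord.ToType
  have hK : #K = mu := Cardinal.mk_ord_toType mu
  have hKinf : Infinite K := by
    rw [Cardinal.infinite_iff, hK]
    by_contra hfin
    have : lam < ℵ₀ := by
      rw [hmu]
      exact Cardinal.power_lt_aleph0 Cardinal.natCast_lt_aleph0 (not_le.1 hfin)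
    exact lt_asymm this hlam
  obtain ⟨a, ha⟩ := hsat'.exists_shattered hlam.le (K := K) (hK ▸ hmulam) hS.swap hSind.swap
  let c : K → M := fun i => a i 0
  have hc : ∀ S : Set K, ∃ b, ∀ i, ψ.Realize (Sum.elim (fun _ => c i) b) ↔ i ∈ S := by
    intro S
    obtain ⟨b, hb⟩ := ha S
    refine ⟨b, fun i => ?_⟩
    rw [hψ, ← hb i]
    have : (fun _ => c i) = a i := by
      funext t
      rw [Subsingleton.elim t 0]
    rw [this]
  let F : Ultrafilter K → Quotient (conjugacy L M) := fun D =>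
    Quotient.mk _ ((L.elementaryDiagram M).averageType D c)
  -- A fibre embeds into the maps `K → M` by sending an ultrafilter to the restriction to `c` of a
  -- chosen conjugating automorphism.
  have hfib : ∀ q, Cardinal.lift.{max u v w} #(F ⁻¹' {q}) ≤
      Cardinal.lift.{max u v w} lam := by
    intro q
    rw [Cardinal.lift_le]
    induction q using Quotient.inductionOn with
    | h p =>
    have hconj : ∀ D : F ⁻¹' {Quotient.mk (conjugacy L M) p}, ∃ g : M ≃[L] M, ∀ b : γ → M,
        instParams ψ b ∈ (L.elementaryDiagram M).averageType D.1 c ↔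
          instParams ψ (g ∘ b) ∈ p := by
      intro D
      obtain ⟨g, hg⟩ := Conjugate.instParams_mem_iff (Quotient.exact D.2)
      exact ⟨g, hg ψ⟩
    choose g hg using hconj
    calc #(F ⁻¹' {Quotient.mk (conjugacy L M) p}) ≤ #(K → M) :=
          Cardinal.mk_le_of_injective (f := fun D => g D ∘ c) fun D D' hDD' =>
            Subtype.ext (eq_of_conjugate_averageType hc (hg D) (hg D') hDD')
      _ = lam ^ mu := by simp [hK, hM]
      _ ≤ lam ^< lam := Cardinal.le_powerlt lam hmulam
      _ = lam := hpow
  have hcount := Cardinal.lift_mk_le_lift_mk_mul_of_lift_mk_preimage_le F hfib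
  have hult : (2 : Cardinal.{w}) ^ lam ≤ #(Ultrafilter K) := by
    have := two_power_two_power_le_mk_ultrafilter K
    rwa [hK, ← hmu] at this
  -- Fewer than `2 ^ lam` classes with fibres of size at most `lam` could not accommodate `2 ^ lam`
  -- ultrafilters.
  by_contra hlt
  rw [not_le] at hlt
  have hlt' : L.numTypesUpToConj M * Cardinal.lift.{max u v} lam <
      Cardinal.lift.{max u v} (2 ^ lam) := by
    refine Cardinal.mul_lt_of_lt ?_ hlt (Cardinal.lift_lt.2 (Cardinal.cantor lam))
    exact Cardinal.aleph0_le_lift.2 (hlam.le.trans (Cardinal.cantor lam).le)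
  refine absurd hlt' (not_lt.2 ?_)
  refine (Cardinal.lift_le.2 hult).trans ?_
  have hlift : ∀ x : Cardinal.{w}, Cardinal.lift.{max u v w} x = Cardinal.lift.{max u v} x :=
    fun x => congrFun Cardinal.lift_umax.{w, max u v} x
  rw [hlift, hlift, Cardinal.lift_id'.{w, max u v}] at hcount
  exact hcount

end

end FirstOrder.Language

/-! ### The unstable dependent case -/

namespace FirstOrder.Language

section

variable {L : Language.{u, v}} {M : Type w} [L.Structure M] [Nonempty M]

/-- In a saturated structure, an ordered relation that is not independent is witnessed along every
small linear order by sequences on which it is eventually constant. -/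
theorem IsSaturatedAt.exists_ordered_eventually_const {κ : Cardinal.{w}} (hκ : ℵ₀ < κ)
    (h : IsSaturatedAt L M κ) {α β : Type} [Finite α] [Finite β]
    {R : (α → M) → (β → M) → Prop} (hR : DefinableRel L R) (hord : OrderedRel R)
    (hind : ¬IndependentRel R) (K : Type w) [LinearOrder K] [Nonempty K] [NoMaxOrder K]
    (hK : #K < κ) :
    ∃ (a : K → α → M) (b : K → β → M), (∀ i j, R (a i) (b j) ↔ i < j) ∧
      ∀ d, ∃ (t : K) (q : Prop), ∀ i, t ≤ i → (R (a i) d ↔ q) := by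
  obtain ⟨N, hN⟩ := not_forall.1 hind
  choose E E' hE using hord
  obtain ⟨a₀, b₀, hab₀, -⟩ := h.exists_ordered hκ.le (K := ULift.{w} ℕ) (by simpa using hκ) hR
    E E' hE
  -- Homogeneity is arranged on a countable sequence before stretching it to `K`. Realizability of a
  -- pattern and its negation are both definable, so both survive the stretching.
  obtain ⟨s, hs, k, hk⟩ := exists_strictMono_homogeneous (N * 1) fun e : Fin (N * 1) → ℕ =>
    {r : Set (Fin N) | ∃ d, ∀ l, R (a₀ ⟨e (finProdFinEquiv (l, 0))⟩) d ↔ l ∈ r}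
  obtain ⟨a, b, hab, hQ⟩ := h.exists_ordered hκ.le hK hR (fun m i => a₀ ⟨s i⟩)
    (fun m i => b₀ ⟨s i⟩) fun m i j => (hab₀ _ _).trans (hs.lt_iff_lt)
  refine ⟨a, b, hab, fun d => ?_⟩
  let Q : Set (Fin N) → Set (Fin (N * 1) × α → M) := fun r =>
    {v | ∃ d, ∀ l, R (fun t => v (finProdFinEquiv (l, 0), t)) d ↔ l ∈ r}
  have hQdef : ∀ r, (∅ : Set M).Definable L (Q r) := fun r =>
    (hR.definable_pattern (· ∈ r)).preimage_comp
      fun q : Fin N × α => ((finProdFinEquiv (q.1, 0), q.2) : Fin (N * 1) × α)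
  have hhom : ∀ r (e : Fin (N * 1) → K), StrictMono e →
      ((fun q => a (e q.1) q.2) ∈ Q r ↔ r ∈ k) := by
    intro r e he
    have hmem : ∀ (m : ℕ) (f : Fin (N * 1) → Fin m), StrictMono f →
        ((fun q : Fin (N * 1) × α => a₀ ⟨s (f q.1)⟩ q.2) ∈ Q r ↔ r ∈ k) := by
      intro m f hf
      rw [← hk (fun i => f i) hf]
      rfl
    by_cases hr : r ∈ k
    · exact iff_of_true (hQ _ _ (hQdef r) (fun m f hf => (hmem m f hf).2 hr) e he) hr
    · exact iff_of_false (hQ _ _ (hQdef r).compl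
        (fun m f hf => fun h' => hr ((hmem m f hf).1 h')) e he) hr
  obtain ⟨t, q, htq⟩ := eventually_const_of_homogeneous (n := 1) (N := N)
    (fun (x : Fin 1 → α → M) (y : β → M) => R (x 0) y) (by
      rintro ⟨x, y, hxy⟩
      exact hN ⟨fun i => x i 0, y, hxy⟩) a (by
      intro r e e' he he' hr
      exact (hhom r e' he').2 ((hhom r e he).1 hr)) d
  exact ⟨t, q, fun i hi => htq (fun _ => i) (Subsingleton.strictMono _) fun _ => hi⟩

/-- The average type of a strictly ordered sequence without last element is not conjugate to the
type of an element of the structure. -/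
theorem not_conjugate_typeOf_averageType {β : Type} {φ : L.Formula (Fin 1 ⊕ β)} {K : Type*}
    [LinearOrder K] [Nonempty K] [NoMaxOrder K] {a : K → M} {b : K → β → M}
    (hab : ∀ i j, φ.Realize (Sum.elim (fun _ => a i) (b j)) ↔ i < j) {D : Ultrafilter K}
    (hD : (D : Filter K) ≤ Filter.atTop) (m : M) :
    ¬Conjugate ((L.elementaryDiagram M).typeOf fun _ => m)
      ((L.elementaryDiagram M).averageType D a) := by
  intro h
  obtain ⟨g, hg⟩ := h.instParams_mem_iff
  -- The formula `x = y`: conjugacy with a realized type would make `a` constant on a set in `D`,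
  -- which is impossible for distinct indices of an ordered sequence.
  let ε : L.Formula (Fin 1 ⊕ Fin 1) :=
    Term.equal (Term.var (Sum.inl 0)) (Term.var (Sum.inr 0))
  have hε : ∀ x y : Fin 1 → M, ε.Realize (Sum.elim x y) ↔ x 0 = y 0 := by
    intro x y
    simp [ε, Formula.realize_equal]
  have h1 := (hg ε fun _ => m).1 ((instParams_mem_typeOf _ _ _).2 ((hε _ _).2 rfl))
  rw [instParams_mem_averageType] at h1
  simp only [hε] at h1
  obtain ⟨i, hi⟩ := h1.exists
  obtain ⟨j, hj, hij⟩ := (h1.and (hD (Filter.eventually_gt_atTop i))).exists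
  have hji : a i = a j := hi.trans hj.symm
  have := (hab i j).2 hij
  rw [hji] at this
  exact lt_irrefl _ ((hab j j).1 this)

/-- In a saturated structure, average types of two ordered sequences on which the ordering formula
is eventually constant are not conjugate if the lengths have different cofinalities. -/
theorem IsSaturatedAt.not_conjugate_averageType {κ : Cardinal.{w}} (hκ : ℵ₀ ≤ κ)
    (h : IsSaturatedAt L M κ) {β : Type} [Finite β] {φ : L.Formula (Fin 1 ⊕ β)} {K K' : Type w}
    [LinearOrder K] [Nonempty K] [LinearOrder K'] [Nonempty K'] [NoMaxOrder K']
    (hK : #K < κ) (hK' : #K' < κ)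
    (hKK' : ∀ f : K' → K, ∃ i, ∀ j₀, ∃ j, j₀ ≤ j ∧ f j = i)
    {a : K → M} (hconst : ∀ d, ∃ (t : K) (q : Prop), ∀ i, t ≤ i →
      (φ.Realize (Sum.elim (fun _ => a i) d) ↔ q))
    {c : K' → M} {d : K' → β → M}
    (hcd : ∀ i j, φ.Realize (Sum.elim (fun _ => c i) (d j)) ↔ i < j)
    {D : Ultrafilter K} (hD : (D : Filter K) ≤ Filter.atTop)
    {D' : Ultrafilter K'} (hD' : (D' : Filter K') ≤ Filter.atTop) :
    ¬Conjugate ((L.elementaryDiagram M).averageType D a)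
      ((L.elementaryDiagram M).averageType D' c) := by
  intro hconj
  obtain ⟨g, hg⟩ := hconj.instParams_mem_iff
  have hg' : ∀ y : β → M, (∀ᶠ i in D, φ.Realize (Sum.elim (fun _ => a i) y)) ↔
      ∀ᶠ j in D', φ.Realize (Sum.elim (fun _ => c j) (g ∘ y)) := by
    intro y
    rw [← instParams_mem_averageType, ← instParams_mem_averageType]
    exact hg φ y
  have hgφ : ∀ (x : M) (y : β → M), φ.Realize (Sum.elim (fun _ => g x) (g ∘ y)) ↔
      φ.Realize (Sum.elim (fun _ => x) y) := by
    intro x y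
    rw [← StrongHomClass.realize_formula g (v := Sum.elim (fun _ => x) y), Sum.comp_elim]
    rfl
  have hgsymm : ∀ y : β → M, g ∘ (g.symm ∘ y) = y := fun y =>
    funext fun t => g.apply_symm_apply _
  -- The instance at `d j` fails on a tail of `c`, hence is absent from the average of `c`. Pulled
  -- back by `g` it is absent from the average of `a`, so by eventual constancy it fails on a tail
  -- of `a`.
  have hev : ∀ j, ∃ t : K, ∀ i, t ≤ i →
      ¬φ.Realize (Sum.elim (fun _ => a i) (g.symm ∘ d j)) := by
    intro j
    obtain ⟨t, q, htq⟩ := hconst (g.symm ∘ d j)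
    refine ⟨t, fun i hi => ?_⟩
    rw [htq i hi]
    intro hq
    have h1 : ∀ᶠ i in D, φ.Realize (Sum.elim (fun _ => a i) (g.symm ∘ d j)) := by
      filter_upwards [hD (Filter.eventually_ge_atTop t)] with i hi using (htq i hi).2 hq
    rw [hg', hgsymm] at h1
    obtain ⟨j', hj', hjj'⟩ := (h1.and (hD' (Filter.eventually_ge_atTop j))).exists
    exact absurd ((hcd j' j).1 hj') (not_lt.2 hjj')
  choose t ht using hev
  obtain ⟨i₀, hi₀⟩ := hKK' t
  -- One bound `i₀` serves cofinally many `j`, so `g.symm ∘ d j` with such a large `j` satisfies any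
  -- finite part of: false at all `a i` with `i₀ ≤ i`, true at all `g.symm (c j)`. A realization `y`
  -- separates the two averages that `g` should match.
  obtain ⟨y, hy⟩ := h.exists_tuple hκ (J := {i // i₀ ≤ i} ⊕ K') (by
      rw [Cardinal.mk_sum, Cardinal.lift_id, Cardinal.lift_id]
      exact Cardinal.add_lt_of_lt hκ ((Cardinal.mk_subtype_le _).trans_lt hK) hK')
    (definableRel_realize φ)
    (Sum.elim (fun i _ => a i) fun j _ => g.symm (c j)) (fun q => q.isRight = true) (by
      intro s
      obtain ⟨j₁, hj₁⟩ := (s.toRight).exists_le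
      obtain ⟨j₂, hj₂⟩ := exists_gt j₁
      obtain ⟨j, hj, htj⟩ := hi₀ j₂
      refine ⟨g.symm ∘ d j, fun q hq => ?_⟩
      rcases q with ⟨i, hi⟩ | j'
      · simpa using ht j i (htj ▸ hi)
      · have hlt : j' < j := ((hj₁ j' (by simpa using hq)).trans_lt hj₂).trans_le hj
        have h1 := (hcd j' j).2 hlt
        rw [← g.apply_symm_apply (c j'), ← hgsymm (d j), hgφ] at h1
        exact iff_of_true h1 rfl)
  have h1 : ∀ᶠ j in D', φ.Realize (Sum.elim (fun _ => c j) (g ∘ y)) := by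
    refine Filter.Eventually.of_forall fun j => ?_
    have h2 := (hy (Sum.inr j)).2 rfl
    rw [← g.apply_symm_apply (c j), hgφ]
    exact h2
  rw [← hg'] at h1
  obtain ⟨i, hi, hii⟩ := (h1.and (hD (Filter.eventually_ge_atTop i₀))).exists
  have := (hy (Sum.inl ⟨i, hii⟩)).1 hi
  simp at this

/-- Since `θ` is regular and `κ < θ`, some fibre has full size `θ`; it is unbounded because proper
initial segments of `θ` are smaller. -/
theorem exists_unbounded_fiber {κ θ : Cardinal.{w}} (hθ : θ.IsRegular) (hκθ : κ < θ)
    (f : θ.ord.ToType → κ.ord.ToType) : ∃ i, ∀ j₀, ∃ j, j₀ ≤ j ∧ f j = i := by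
  obtain ⟨i, hi⟩ := Cardinal.infinite_pigeonhole f (by simpa using hθ.aleph0_le)
    (by simpa [hθ.cof_ord] using hκθ)
  refine ⟨i, fun j₀ => ?_⟩
  by_contra hcon
  push Not at hcon
  have hsub : f ⁻¹' {i} ⊆ Set.Iio j₀ := fun j hj => not_le.1 fun hle => hcon j hle hj
  have := (Cardinal.mk_le_mk_of_subset hsub).trans_lt (Cardinal.mk_Iio_lt j₀ (by simp))
  exact this.ne hi

/-- A saturated model of an unstable dependent theory has pairwise nonconjugate unrealized types
indexed by the regular cardinals below its cardinality. -/
theorem Theory.IsDependent.exists_nonconjugate {T : L.Theory} [M ⊨ T] (hT : T.IsComplete)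
    (hunst : ¬T.IsStable) (hdep : T.IsDependent) {lam : Cardinal.{w}} (hlam : ℵ₀ < lam)
    (hsat : IsSaturatedAt L M lam) :
    ∃ p : {κ : Cardinal.{w} // κ.IsRegular ∧ κ < lam} → OneTypes L M,
      (∀ κ κ', κ ≠ κ' → ¬Conjugate (p κ) (p κ')) ∧
      ∀ κ (m : M), ¬Conjugate ((L.elementaryDiagram M).typeOf fun _ => m) (p κ) := by
  rw [Theory.IsStable, not_not] at hunst
  obtain ⟨k, m, φ, hφ⟩ := hunst
  rw [hT.hasOrderProperty_iff M] at hφ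
  obtain ⟨γ, _, S, hS, hSord⟩ := hsat.exists_orderedRel_single hlam m _
    (definableRel_realize φ) hφ
  obtain ⟨ψ, hψ⟩ := hS.swap.exists_formula
  have hSind := hdep.not_independentRel hT hS.swap
  let I := {κ : Cardinal.{w} // κ.IsRegular ∧ κ < lam}
  let K : I → Type w := fun κ => κ.1.ord.ToType
  have hne : ∀ κ : I, Nonempty (K κ) := fun κ => by
    rw [← Cardinal.mk_ne_zero_iff, Cardinal.mk_ord_toType]
    exact κ.2.1.pos.ne'
  have hmax : ∀ κ : I, NoMaxOrder (K κ) := fun κ => Cardinal.noMaxOrder κ.2.1.aleph0_le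
  have hK : ∀ κ : I, #(K κ) < lam := fun κ => by
    rw [Cardinal.mk_ord_toType]
    exact κ.2.2
  choose a b hab hconst using fun κ : I =>
    hsat.exists_ordered_eventually_const hlam hS.swap hSord.swap hSind (K κ) (hK κ)
  let c : ∀ κ, K κ → M := fun κ i => a κ i 0
  have hca : ∀ κ i, (fun _ => c κ i) = a κ i := fun κ i => by
    funext t
    rw [Subsingleton.elim t 0]
  have hcb : ∀ κ i j, ψ.Realize (Sum.elim (fun _ => c κ i) (b κ j)) ↔ i < j := by
    intro κ i j
    rw [hca, hψ]
    exact hab κ i j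
  have hc : ∀ κ d, ∃ (t : K κ) (q : Prop), ∀ i, t ≤ i →
      (ψ.Realize (Sum.elim (fun _ => c κ i) d) ↔ q) := by
    intro κ d
    obtain ⟨t, q, htq⟩ := hconst κ d
    refine ⟨t, q, fun i hi => ?_⟩
    rw [hca, hψ]
    exact htq i hi
  let D : ∀ κ : I, Ultrafilter (K κ) := fun κ => Ultrafilter.of Filter.atTop
  have hD : ∀ κ, (D κ : Filter (K κ)) ≤ Filter.atTop := fun κ => Ultrafilter.of_le _
  have hlt : ∀ κ κ' : I, κ.1 < κ'.1 → ¬Conjugate ((L.elementaryDiagram M).averageType (D κ) (c κ))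
      ((L.elementaryDiagram M).averageType (D κ') (c κ')) := fun κ κ' hκκ' =>
    hsat.not_conjugate_averageType hlam.le (hK κ) (hK κ')
      (exists_unbounded_fiber κ'.2.1 hκκ') (hc κ) (hcb κ') (hD κ) (hD κ')
  refine ⟨fun κ => (L.elementaryDiagram M).averageType (D κ) (c κ), fun κ κ' hκκ' => ?_,
    fun κ m => not_conjugate_typeOf_averageType (hcb κ) (hD κ) m⟩
  rcases lt_or_gt_of_ne (fun h => hκκ' (Subtype.ext h) : κ.1 ≠ κ'.1) with h | h
  · exact hlt κ κ' h
  · exact fun hconj => hlt κ' κ h ((conjugacy L M).symm hconj)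

theorem Theory.IsDependent.card_le_numTypesUpToConj {T : L.Theory} [M ⊨ T] (hT : T.IsComplete)
    (hunst : ¬T.IsStable) (hdep : T.IsDependent) {ζ : Ordinal.{w}} (hζ : ℵ₀ < ℵ_ ζ)
    (hsat : IsSaturatedAt L M (ℵ_ ζ)) :
    Cardinal.lift.{max u v} (ζ + 1).card ≤ L.numTypesUpToConj M := by
  obtain ⟨p, hp, hpm⟩ := hdep.exists_nonconjugate hT hunst hζ hsat
  let e : ζ.ToType ≃o Set.Iio ζ := Ordinal.ToType.mk.symm
  -- Successor alephs are regular, so `x` is sent to `x + 1`. The only `x` with `x + 1 = ζ`, if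
  -- there is one, takes the unused value `0`, whose aleph is regular too; this gives exactly `|ζ|`
  -- indices.
  let o : ζ.ToType → Ordinal.{w} := fun x =>
    if (e x : Ordinal.{w}) + 1 < ζ then (e x : Ordinal.{w}) + 1 else 0
  have hreg : ∀ x, (ℵ_ (o x)).IsRegular ∧ ℵ_ (o x) < ℵ_ ζ := by
    intro x
    simp only [o]
    split_ifs with hx
    · exact ⟨Cardinal.isRegular_aleph_add_one _, Cardinal.aleph_lt_aleph.2 hx⟩
    · rw [Cardinal.aleph_zero]
      exact ⟨Cardinal.isRegular_aleph0, hζ⟩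
  have ho : Function.Injective o := by
    intro x y hxy
    have hsucc : ∀ z : ζ.ToType, ¬(e z : Ordinal.{w}) + 1 < ζ → (e z : Ordinal.{w}) + 1 = ζ :=
      fun z hz => le_antisymm (Order.add_one_le_of_lt (e z).2) (not_lt.1 hz)
    have hinj : (e x : Ordinal.{w}) + 1 = e y + 1 → x = y := fun h =>
      e.injective (Subtype.ext (Order.succ_injective (by simpa using h)))
    simp only [o] at hxy
    split_ifs at hxy with h1 h2 h2
    · exact hinj hxy
    · exact absurd hxy (by simp)
    · exact absurd hxy.symm (by simp)
    · exact hinj ((hsucc x h1).trans (hsucc y h2).symm)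
  -- `none` stands for the class of a realized type, which accounts for the `+ 1`.
  let F : Option ζ.ToType → Quotient (conjugacy L M) := fun x => Quotient.mk _
    (x.elim ((L.elementaryDiagram M).typeOf fun _ => Classical.arbitrary M)
      fun x => p ⟨_, hreg x⟩)
  have hF : Function.Injective F := by
    have h1 : ∀ x y : ζ.ToType, F (some x) = F (some y) → x = y := by
      intro x y hxy
      by_contra hne
      refine hp ⟨_, hreg x⟩ ⟨_, hreg y⟩ (fun h => hne (ho ?_)) (Quotient.exact hxy)
      exact Cardinal.aleph.injective (Subtype.ext_iff.1 h)
    rintro (_ | x) (_ | y) hxy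
    · rfl
    · exact absurd (Quotient.exact hxy) (hpm _ _)
    · exact absurd (Quotient.exact hxy.symm) (hpm _ _)
    · exact congrArg some (h1 x y hxy)
  have := Cardinal.lift_mk_le_lift_mk_of_injective hF
  have hlift : ∀ x : Cardinal.{w}, Cardinal.lift.{max u v w} x = Cardinal.lift.{max u v} x :=
    fun x => congrFun Cardinal.lift_umax.{w, max u v} x
  rw [hlift, Cardinal.lift_id'.{w, max u v}, Cardinal.mk_option, Cardinal.mk_toType] at this
  rwa [Ordinal.card_add, Ordinal.card_one]

end

end FirstOrder.Language

theorem mainTheorem12 {L : FirstOrder.Language.{u, v}} (T : L.Theory) (hT : T.IsComplete) :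
    (T.IsIndependent →
      ∀ (M : Type w) [L.Structure M] [Nonempty M] [M ⊨ T] (lam : Cardinal.{w}),
        #M = lam →
        L.IsSaturated M →
        lam ^< lam = lam →
        (∃ mu : Cardinal.{w}, lam = 2 ^ mu) →
        Cardinal.lift.{w} T.size < Cardinal.lift.{max u v} lam →
        L.numTypesUpToConj M = Cardinal.lift.{max u v} (2 ^ lam)) ∧
    (¬ T.IsStable → T.IsDependent →
      ∀ (M : Type w) [L.Structure M] [Nonempty M] [M ⊨ T] (ζ : Ordinal.{w}),
        #M = ℵ_ ζ →
        L.IsSaturated M →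
        (ℵ_ ζ : Cardinal.{w}) ^< ℵ_ ζ = ℵ_ ζ →
        Cardinal.lift.{w} T.size < Cardinal.lift.{max u v} (ℵ_ ζ) →
        Cardinal.lift.{max u v} (ζ + 1).card ≤ L.numTypesUpToConj M) := by
  refine ⟨fun hind M _ _ _ lam hM hsat hpow ⟨mu, hmu⟩ hL =>
    hind.numTypesUpToConj_eq hT hM hsat hpow hmu hL,
    fun hunst hdep M _ _ _ ζ hM hsat _ hL =>
      hdep.card_le_numTypesUpToConj hT hunst (FirstOrder.Language.Theory.aleph0_lt_of_size_lt hL) (hM ▸ hsat)⟩
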